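/- **Setting.** Let $(\Omega,\mathcal F,\mathsf P)$ be a probability space, $L^0$ the space of real random variables up to $\mathsf P$-a.s. equality, and $\mathcal P$ the set of probability measures on $\mathcal F$ that are absolutely continuous with respect to $\mathsf P$. For $\mathsf Q\in\mathcal P$ and $X\in L^0$ put $\mathsf E_{\mathsf Q}X=\mathsf E_{\mathsf Q}X^+-\mathsf E_{\mathsf Q}X^-\in[-\infty,\infty]$ with the convention $\infty-\infty=-\infty$. Infima over the empty set are $+\infty$. A *coherent utility function* is a map $u:L^0\to[-\infty,\infty]$ of the form $u(X)=\inf_{\mathsf Q\in\mathcal D'}\mathsf E_{\mathsf Q}X$ with a nonempty $\mathcal D'\subseteq\mathcal P$; its *determining set* is the largest such set, $\{\mathsf Q\in\mathcal P:\mathsf E_{\mathsf Q}X\ge u(X)\text{ for all }X\in L^0\}$. For $\mathcal D\subseteq\mathcal P$ and $A\subseteq L^0$ let - $L^1_s(\mathcal D)=\{X\in L^0:\lim_{k\to\infty}\sup_{\mathsf Q\in\mathcal D}\mathsf E_{\mathsf Q}|X|I(|X|>k)=0\}$ (a supremum over the empty set being $0$ here, so that $L^1_s(\emptyset)=L^0$);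 - $\mathcal R(A)=\{\mathsf Q\in\mathcal P:\mathsf E_{\mathsf Q}X\le0\text{ for all }X\in A\}$; - $\mathcal X_{\mathcal D}(X)=\{\mathsf Q\in\mathcal D:\mathsf E_{\mathsf Q}X=\inf_{\mathsf Q'\in\mathcal D}\mathsf E_{\mathsf Q'}X\in(-\infty,\infty)\}$. The set $A$ is *$\mathcal D$-consistent* if there is $A'\subseteq A\cap L^1_s(\mathcal D)$ with $\mathcal D\cap\mathcal R(A)=\mathcal D\cap\mathcal R(A')$. Let $u_1,\dots,u_N$ be coherent utility functions whose determining sets $\mathcal D_1,\dots,\mathcal D_N$ are weakly compact (identifying measures with their densities, in the weak topology of $L^1(\mathsf P)$), let $A_1,\dots,A_N\subseteq L^0$ be convex cones containing $0$ such that $A_n$ is $\mathcal D_n$-consistent, let $W_n\in L^1_s(\mathcal D_n)$, and put $W=\sum_nW_n$ and $\mathcal D=\bigcap_n\mathcal D_n$. A pair $(X,Y)=(X_1,\dots,X_N,Y_1,\dots,Y_N)$ is *feasible* if $X_n\in A_n$, $Y_n\in L^1_s(\mathcal D)$ and $\sum_nY_n=0$. Let $$M=\sup_{(X,Y)\text{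 feasible}}\ \sum_{n=1}^Nu_n(W_n+X_n+Y_n),$$ where a sum with a summand $-\infty$ is $-\infty$. - A *Pareto-type equilibrium* is a feasible $(X,Y)$ for which there is no feasible $(X',Y')$ with $u_n(W_n+X'_n+Y'_n)\ge u_n(W_n+X_n+Y_n)$ for all $n$ and with strict inequality for some $n$. - An *Arrow–Debreu-type equilibrium* is a triple $(X,Y,\mathsf Q)$ with $(X,Y)$ feasible, $\mathsf Q\in\mathcal P$, $\mathsf E_{\mathsf Q}Y_n=0$ for all $n$, and, for all $n$, $$u_n(W_n+X_n+Y_n)=\max\{u_n(W_n+\xi+\eta):\ \xi\in A_n,\ \eta\in L^0,\ \eta\ \mathsf Q\text{-integrable},\ \mathsf E_{\mathsf Q}\eta=0\}.$$ - $Y'\sim Y$ means that $Y'_n=Y_n+a_n$ for some $a_1,\dots,a_N\in\mathbb R$ with $\sum_na_n=0$. - $\mathcal E(X,Y)$ is the set of $\mathsf Q\in\mathcal P$ such that $(X,Y',\mathsf Q)$ is an Arrow–Debreu-type equilibrium for some $Y'\sim Y$. **Theorem (unconstrained equilibrium).** One has $M<\infty$ if and only if $\bigcap_n\mathcal D_n\cap\mathcal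 R(A_n)\ne\emptyset$. Assume that $M<\infty$ and let $(X,Y)$ be feasible. The following conditions are equivalent: - (i) $(X,Y)$ is a Pareto-type equilibrium; - (ii) there exist $\mathsf Q\in\mathcal P$ and $Y'\sim Y$ such that $(X,Y',\mathsf Q)$ is an Arrow–Debreu-type equilibrium. If these conditions are satisfied, then $$\mathcal E(X,Y)=\mathcal X_{\bigcap_n\mathcal D_n\cap\mathcal R(A_n)}(W).$$ If each $A_n$ is a linear space, then (i) and (ii) are also equivalent to - (iii) $\bigcap_n\mathcal X_{\mathcal D_n}(W_n+X_n+Y_n)\cap\mathcal R(A_n)\ne\emptyset$, and moreover (whether or not these conditions are satisfied) $$\mathcal E(X,Y)=\bigcap_{n=1}^N\mathcal X_{\mathcal D_n}(W_n+X_n+Y_n)\cap\mathcal R(A_n).$$ -/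

import Mathlib

open MeasureTheory Filter Topology

namespace CoherentEquilibrium

variable {Ω : Type*} [MeasurableSpace Ω]

/-- The space `L⁰` of real random variables on `(Ω, 𝓕, P)`, up to `P`-a.s. equality. -/
abbrev L0 (P : Measure Ω) := Ω →ₘ[P] ℝ

/-- The set `𝒫` of probability measures that are absolutely continuous with respect to `P`. -/
abbrev ACProb (P : Measure Ω) := {Q : Measure Ω // IsProbabilityMeasure Q ∧ Q ≪ P}

variable {P : Measure Ω}

/-- The expectation `E_Q X = E_Q X⁺ - E_Q X⁻ ∈ [-∞, ∞]` of an arbitrary `X ∈ L⁰`, with the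
convention `∞ - ∞ = -∞` (this is the convention of subtraction in `EReal`).
As `Q ≪ P`, it does not depend on the representative of `X`. -/
noncomputable def expect (Q : ACProb P) (X : L0 P) : EReal :=
  ((∫⁻ ω, ENNReal.ofReal (X ω) ∂Q.1 : ENNReal) : EReal) -
    ((∫⁻ ω, ENNReal.ofReal (-X ω) ∂Q.1 : ENNReal) : EReal)

/-- A coherent utility function on `L⁰`: a map of the form `u(X) = inf_{Q ∈ D} E_Q X` with a
nonempty set `D ⊆ 𝒫`. -/
def IsCoherentUtility (u : L0 P → EReal) : Prop :=
  ∃ D : Set (ACProb P), D.Nonempty ∧ ∀ X, u X = ⨅ Q ∈ D, expect Q X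

/-- The determining set of `u`: the largest set `D ⊆ 𝒫` with `u(X) = inf_{Q ∈ D} E_Q X`. -/
def determiningSet (u : L0 P → EReal) : Set (ACProb P) :=
  {Q | ∀ X, u X ≤ expect Q X}

/-- The density `dQ/dP` as an element of `L¹(P)`. -/
noncomputable def density (Q : ACProb P) : Lp ℝ 1 P :=
  haveI := Q.2.1
  (Measure.integrable_toReal_rnDeriv (μ := Q.1) (ν := P)).toL1
    (fun ω => (Q.1.rnDeriv P ω).toReal)

/-- Weak compactness of a set of measures, identified with the set of their densities in
`L¹(P)`, with respect to the weak topology of the Banach space `L¹(P)`. -/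
def IsWeaklyCompact (D : Set (ACProb P)) : Prop :=
  IsCompact ((fun Q => toWeakSpace ℝ (Lp ℝ 1 P) (density Q)) '' D)

/-- The strong `L¹`-space `L¹_s(D)`: all `X ∈ L⁰` such that
`sup_{Q ∈ D} E_Q |X| 1_{|X| > k} → 0` as `k → ∞`. -/
def Ls1 (D : Set (ACProb P)) : Set (L0 P) :=
  {X | Tendsto (fun k : ℕ => ⨆ Q ∈ D, ∫⁻ ω in {ω | (k : ℝ) < |X ω|}, ENNReal.ofReal |X ω| ∂Q.1)
    atTop (𝓝 0)}

/-- The set `ℛ(A)` of risk-neutral measures: all `Q ∈ 𝒫` with `E_Q X ≤ 0` for each `X ∈ A`. -/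
def riskNeutral (A : Set (L0 P)) : Set (ACProb P) :=
  {Q | ∀ X ∈ A, expect Q X ≤ 0}

/-- `A` is `D`-consistent: there is `A' ⊆ A ∩ L¹_s(D)` with `D ∩ ℛ(A) = D ∩ ℛ(A')`. -/
def IsConsistent (D : Set (ACProb P)) (A : Set (L0 P)) : Prop :=
  ∃ A' : Set (L0 P), A' ⊆ A ∩ Ls1 D ∧ D ∩ riskNeutral A = D ∩ riskNeutral A'

/-- The set `𝒳_D(X)` of extreme measures: all `Q ∈ D` with
`E_Q X = inf_{Q' ∈ D} E_{Q'} X ∈ (-∞, ∞)`. -/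
def extremeMeasures (D : Set (ACProb P)) (X : L0 P) : Set (ACProb P) :=
  {Q | Q ∈ D ∧ expect Q X = (⨅ Q' ∈ D, expect Q' X) ∧ expect Q X ≠ ⊥ ∧ expect Q X ≠ ⊤}

section Equilibrium

variable {N : ℕ}

/-- The set `D = ⋂ₙ Dₙ` of measures common to the determining sets of all the agents. -/
def commonSet (u : Fin N → L0 P → EReal) : Set (ACProb P) :=
  ⋂ n, determiningSet (u n)

/-- Feasible allocations `(X, Y)`: `Xₙ ∈ Aₙ`, `Yₙ ∈ L¹_s(⋂ₘ Dₘ)` and `∑ₙ Yₙ = 0`. -/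
def IsFeasible (u : Fin N → L0 P → EReal) (A : Fin N → PointedCone ℝ (L0 P)) (X Y : Fin N → L0 P) : Prop :=
  (∀ n, X n ∈ A n) ∧ (∀ n, Y n ∈ Ls1 (commonSet u)) ∧ ∑ n, Y n = 0

/-- The maximal overall utility `M`. In `EReal` a sum with a summand `-∞` equals `-∞`. -/
noncomputable def maxOverallUtility (u : Fin N → L0 P → EReal) (A : Fin N → PointedCone ℝ (L0 P))
    (W : Fin N → L0 P) : EReal :=
  sSup {s | ∃ X Y, IsFeasible u A X Y ∧ s = ∑ n, u n (W n + X n + Y n)}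

/-- Pareto-type equilibrium `(X, Y)`. -/
def IsParetoEquilibrium (u : Fin N → L0 P → EReal) (A : Fin N → PointedCone ℝ (L0 P))
    (W X Y : Fin N → L0 P) : Prop :=
  IsFeasible u A X Y ∧
    ¬ ∃ X' Y', IsFeasible u A X' Y' ∧
      (∀ n, u n (W n + X n + Y n) ≤ u n (W n + X' n + Y' n)) ∧
      ∃ n, u n (W n + X n + Y n) < u n (W n + X' n + Y' n)

/-- Arrow-Debreu-type equilibrium `(X, Y, Q)`. The maximum runs over `ξ ∈ Aₙ` and those
`η ∈ L⁰` that are `Q`-integrable with `E_Q η = 0`. -/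
def IsArrowDebreuEquilibrium (u : Fin N → L0 P → EReal) (A : Fin N → PointedCone ℝ (L0 P))
    (W X Y : Fin N → L0 P) (Q : ACProb P) : Prop :=
  IsFeasible u A X Y ∧ (∀ n, expect Q (Y n) = 0) ∧
    ∀ n, IsGreatest
      {v | ∃ ξ ∈ A n, ∃ η : L0 P, Integrable η Q.1 ∧ expect Q η = 0 ∧ v = u n (W n + ξ + η)}
      (u n (W n + X n + Y n))

/-- `Y' ∼ Y`: there are real `a₁, …, a_N` with `∑ₙ aₙ = 0` and `Y'ₙ = Yₙ + aₙ`. -/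
def TransferEquiv (Y' Y : Fin N → L0 P) : Prop :=
  ∃ a : Fin N → ℝ, ∑ n, a n = 0 ∧ ∀ n, Y' n = Y n + AEEqFun.const Ω (a n)

/-- The set `ℰ(X, Y)` of all `Q ∈ 𝒫` such that `(X, Y', Q)` is an Arrow-Debreu-type equilibrium
for some `Y' ∼ Y`. -/
def equilibriumMeasures (u : Fin N → L0 P → EReal) (A : Fin N → PointedCone ℝ (L0 P))
    (W X Y : Fin N → L0 P) : Set (ACProb P) :=
  {Q | ∃ Y', TransferEquiv Y' Y ∧ IsArrowDebreuEquilibrium u A W X Y' Q}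

end Equilibrium

end CoherentEquilibrium

open CoherentEquilibrium

/-! Write C = ⋂ₙ Dₙ ∩ ℛ(Aₙ). For Q ∈ C and a feasible pair, uₙ(Wₙ + Xₙ + Yₙ) ≤ E_Q Wₙ + E_Q Yₙ, and
the transfers cancel in the sum, so the overall utility is at most E_Q W. Everything turns on
measures for which this bound is an equality with finite utilities (`IsSupporting`): both kinds of
equilibrium amount to the existence of such a measure.

The bound is sharp by a minimax argument on the product of the compact sets Dₙ
(`exists_isFeasible_lt`). At a tuple of measures outside the diagonal of C, some direction has
strictly positive gain and can be scaled up (`IsTestDirection.exists_gain`); at a diagonal point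
only E_Q W matters. Hence any r below E_Q W for all Q ∈ C is exceeded by a feasible pair. If C is
empty, this gives M = ∞.

Utilities are cash-additive, so a surplus in the sum can be shared among all agents; a Pareto
optimum therefore has a supporting measure. Centering Y under that measure gives an Arrow–Debreu
equilibrium. Conversely, in such an equilibrium, bounded η force Q ∈ Dₙ
(`mem_determiningSet_of_forall_le`), large multiples of ξ force Q ∈ ℛ(Aₙ), and η = E_Q Wₙ - Wₙ
forces equality in the bound. -/

/-- A minimax theorem: if a convex set `F` of continuous functions on a compact space, affine with
respect to some notion of convex combination, has at each point a member positive there, then it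
has a member positive everywhere. -/
theorem exists_forall_pos_of_forall_exists_pos {α : Type*} [TopologicalSpace α]
    [CompactSpace α] {F : Set (α → ℝ)} (hF : Convex ℝ F) (hne : F.Nonempty)
    (hcont : ∀ f ∈ F, Continuous f)
    (haff : ∀ (k₁ k₂ : α) (a b : ℝ), 0 ≤ a → 0 ≤ b → a + b = 1 →
      ∃ k, ∀ f ∈ F, f k = a * f k₁ + b * f k₂)
    (hpos : ∀ k, ∃ f ∈ F, 0 < f k) :
    ∃ f ∈ F, ∀ k, 0 < f k := by
  classical
  rcases isEmpty_or_nonempty α with _ | ⟨⟨k₀⟩⟩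
  · obtain ⟨f, hf⟩ := hne
    exact ⟨f, hf, fun k => isEmptyElim k⟩
  obtain ⟨t, htF, htpos⟩ : ∃ t : Finset (α → ℝ), (↑t ⊆ F) ∧ ∀ k, ∃ f ∈ t, 0 < f k := by
    suffices h : ∃ t : Finset (α → ℝ), (↑t ⊆ F) ∧ ∀ k ∈ Set.univ, ∃ f ∈ t, 0 < f k by
      simpa using h
    refine isCompact_univ.induction_on (p := fun s => ∃ t : Finset (α → ℝ), (↑t ⊆ F) ∧ ∀ k ∈ s, ∃ f ∈ t, 0 < f k)
      ⟨∅, by simp⟩ ?_ ?_ ?_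
    · rintro s s' hs ⟨t, h1, h2⟩
      exact ⟨t, h1, fun k hk => h2 k (hs hk)⟩
    · rintro s s' ⟨t, h1, h2⟩ ⟨t', h1', h2'⟩
      refine ⟨t ∪ t', by simp [h1, h1'], ?_⟩
      rintro k (hk | hk)
      · obtain ⟨f, hf, h⟩ := h2 k hk
        exact ⟨f, Finset.mem_union_left _ hf, h⟩
      · obtain ⟨f, hf, h⟩ := h2' k hk
        exact ⟨f, Finset.mem_union_right _ hf, h⟩
    · intro k hk
      obtain ⟨f, hf, h⟩ := hpos k
      exact ⟨{k' | 0 < f k'}, mem_nhdsWithin_of_mem_nhds ((hcont f hf).continuousAt.eventually_const_lt h), {f}, by simpa using hf, by simp⟩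
  let Φ : α → (t → ℝ) := fun k f => f.1 k
  have hΦ : Continuous Φ := continuous_pi fun f => hcont _ (htF f.2)
  have hconv : Convex ℝ (Set.range Φ) := by
    rintro _ ⟨k₁, rfl⟩ _ ⟨k₂, rfl⟩ a b ha hb hab
    obtain ⟨k, h⟩ := haff k₁ k₂ a b ha hb hab
    exact ⟨k, funext fun f => h _ (htF f.2)⟩
  have hT : Convex ℝ (Set.Iic (0 : t → ℝ)) := convex_Iic 0
  have hdisj : Disjoint (Set.range Φ) (Set.Iic (0 : t → ℝ)) := by
    rw [Set.disjoint_left]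
    rintro _ ⟨k, rfl⟩ hle
    obtain ⟨f, hf, h⟩ := htpos k
    exact absurd (hle ⟨f, hf⟩) (not_le.2 h)
  -- By compactness finitely many members suffice, so their joint range misses the nonpositive
  -- orthant. The separating functional is minus a nonnegative weighting, and the weighted average
  -- of the members is positive everywhere.
  obtain ⟨l, c, d, hl, hcd, hd⟩ :=
    geometric_hahn_banach_compact_closed hconv (isCompact_range hΦ) hT isClosed_Iic hdisj
  have hd0 : d < 0 := by simpa using hd 0 (by simp)
  set w : t → ℝ := fun f => - l (Pi.single f 1) with hw
  have hw0 : ∀ f, 0 ≤ w f := by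
    intro f
    by_contra! hneg
    have hlpos : 0 < l (Pi.single f 1) := by simpa [hw] using hneg
    -- This multiple of the basis vector lies in the orthant, yet `l` takes the value `d` there,
    -- which strict separation forbids.
    have hmem : (d / l (Pi.single f 1)) • (Pi.single f 1 : t → ℝ) ∈ Set.Iic (0 : t → ℝ) := by
      intro g
      by_cases hg : g = f
      · subst hg
        simpa using (div_neg_of_neg_of_pos hd0 hlpos).le
      · simp [hg]
    have := hd _ hmem
    rw [map_smul, smul_eq_mul, div_mul_cancel₀ _ hlpos.ne'] at this
    exact lt_irrefl _ this
  have hlw : ∀ x : t → ℝ, l x = - ∑ f, w f * x f := by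
    intro x
    conv_lhs => rw [pi_eq_sum_univ' x]
    simp [map_sum, hw]
    refine Finset.sum_congr rfl fun f _ => ?_
    rw [mul_comm]
  have hsum : ∀ k, 0 < ∑ f, w f * Φ k f := by
    intro k
    have := hl _ ⟨k, rfl⟩
    rw [hlw] at this
    linarith
  have hS : 0 < ∑ f, w f := by
    refine lt_of_le_of_ne (Finset.sum_nonneg fun f _ => hw0 f) fun h => ?_
    have hz := (Finset.sum_eq_zero_iff_of_nonneg fun f _ => hw0 f).1 h.symm
    have := hsum k₀
    rw [Finset.sum_eq_zero fun f hf => by rw [hz f hf, zero_mul]] at this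
    exact lt_irrefl _ this
  refine ⟨Finset.univ.centerMass w (fun f => f.1),
    hF.centerMass_mem (fun f _ => hw0 f) hS fun f _ => htF f.2, fun k => ?_⟩
  rw [Finset.centerMass, Pi.smul_apply, Finset.sum_apply, smul_eq_mul]
  exact mul_pos (inv_pos.2 hS) (hsum k)

/-! ### Expectations in `EReal` and real means -/

namespace CoherentEquilibrium

variable {Ω : Type*} [MeasurableSpace Ω] {P : Measure Ω}

instance (Q : ACProb P) : IsProbabilityMeasure Q.1 := Q.2.1

/-- The expectation of `X` under `Q` as a real number, for `Q`-integrable `X`. -/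
noncomputable def mean (Q : ACProb P) (X : L0 P) : ℝ := ∫ ω, X ω ∂Q.1

theorem ae_of_ae (Q : ACProb P) {p : Ω → Prop} (h : ∀ᵐ ω ∂P, p ω) : ∀ᵐ ω ∂Q.1, p ω :=
  Q.2.2.ae_le h

theorem integrable_add {Q : ACProb P} {X Y : L0 P} (hX : Integrable X Q.1) (hY : Integrable Y Q.1) :
    Integrable (X + Y : L0 P) Q.1 :=
  (hX.add hY).congr (EventuallyEq.symm (ae_of_ae Q (AEEqFun.coeFn_add X Y)))

theorem integrable_smul {Q : ACProb P} {X : L0 P} (c : ℝ) (hX : Integrable X Q.1) :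
    Integrable (c • X : L0 P) Q.1 :=
  (hX.smul c).congr (EventuallyEq.symm (ae_of_ae Q (AEEqFun.coeFn_smul c X)))

theorem coeFn_constant (c : ℝ) : (AEEqFun.const Ω c : L0 P) =ᵐ[P] fun _ => c :=
  AEEqFun.coeFn_const _ c

theorem integrable_constant (Q : ACProb P) (c : ℝ) : Integrable (AEEqFun.const Ω c : L0 P) Q.1 :=
  (integrable_const c).congr (EventuallyEq.symm (ae_of_ae Q (coeFn_constant c)))

theorem mean_add {Q : ACProb P} {X Y : L0 P} (hX : Integrable X Q.1) (hY : Integrable Y Q.1) :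
    mean Q (X + Y) = mean Q X + mean Q Y := by
  rw [mean, integral_congr_ae (ae_of_ae Q (AEEqFun.coeFn_add X Y))]
  exact integral_add hX hY

theorem mean_smul (Q : ACProb P) (X : L0 P) (c : ℝ) : mean Q (c • X) = c * mean Q X := by
  rw [mean, integral_congr_ae (ae_of_ae Q (AEEqFun.coeFn_smul c X))]
  exact integral_smul c _

theorem mean_constant (Q : ACProb P) (c : ℝ) : mean Q (AEEqFun.const Ω c : L0 P) = c := by
  rw [mean, integral_congr_ae (ae_of_ae Q (coeFn_constant c))]
  simp

theorem integrable_sum {Q : ACProb P} {ι : Type*} (s : Finset ι) {X : ι → L0 P}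
    (hX : ∀ i ∈ s, Integrable (X i) Q.1) :
    Integrable (∑ i ∈ s, X i : L0 P) Q.1 ∧ mean Q (∑ i ∈ s, X i) = ∑ i ∈ s, mean Q (X i) := by
  classical
  induction s using Finset.induction_on with
  | empty =>
    have h := integrable_smul (0 : ℝ) (integrable_constant Q 0)
    have h' := mean_smul Q (AEEqFun.const Ω 0) 0
    rw [zero_smul] at h h'
    exact ⟨by simpa using h, by simpa using h'⟩
  | insert a s ha ih =>
    obtain ⟨h1, h2⟩ := ih fun i hi => hX i (Finset.mem_insert_of_mem hi)
    have h3 := hX a (Finset.mem_insert_self a s)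
    rw [Finset.sum_insert ha, Finset.sum_insert ha]
    exact ⟨integrable_add h3 h1, by rw [mean_add h3 h1, h2]⟩

theorem expect_of_integrable {Q : ACProb P} {X : L0 P} (hX : Integrable X Q.1) :
    expect Q X = (mean Q X : ℝ) := by
  have h1 : ∫⁻ ω, ENNReal.ofReal (X ω) ∂Q.1 ≠ ⊤ := hX.lintegral_lt_top.ne
  have h2 : ∫⁻ ω, ENNReal.ofReal (-X ω) ∂Q.1 ≠ ⊤ := hX.neg.lintegral_lt_top.ne
  rw [mean, integral_eq_lintegral_pos_part_sub_lintegral_neg_part hX, EReal.coe_sub, expect,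
    EReal.coe_ennreal_toReal h1, EReal.coe_ennreal_toReal h2]

theorem measurable_coe (X : L0 P) : Measurable X := AEEqFun.measurable X

theorem lintegral_neg_ne_top_of_expect_ne_bot {Q : ACProb P} {X : L0 P} (h : expect Q X ≠ ⊥) :
    ∫⁻ ω, ENNReal.ofReal (-X ω) ∂Q.1 ≠ ⊤ := by
  intro h'
  rw [expect, h', EReal.coe_ennreal_top, EReal.sub_top] at h
  exact h rfl

theorem integrable_of_lintegral {Q : ACProb P} {X : L0 P}
    (h1 : ∫⁻ ω, ENNReal.ofReal (X ω) ∂Q.1 ≠ ⊤) (h2 : ∫⁻ ω, ENNReal.ofReal (-X ω) ∂Q.1 ≠ ⊤) :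
    Integrable X Q.1 := by
  refine ⟨(measurable_coe X).aestronglyMeasurable, ?_⟩
  rw [hasFiniteIntegral_iff_norm]
  calc ∫⁻ ω, ENNReal.ofReal ‖X ω‖ ∂Q.1
      ≤ ∫⁻ ω, (ENNReal.ofReal (X ω) + ENNReal.ofReal (-X ω)) ∂Q.1 := by
        refine lintegral_mono fun ω => ?_
        rcases le_total 0 (X ω) with h | h
        · rw [Real.norm_of_nonneg h]; exact le_self_add
        · rw [Real.norm_of_nonpos h]; exact le_add_self
    _ = _ := lintegral_add_left (measurable_coe X).ennreal_ofReal _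
    _ < ⊤ := ENNReal.add_lt_top.2 ⟨h1.lt_top, h2.lt_top⟩

theorem integrable_of_expect {Q : ACProb P} {X : L0 P} (h1 : expect Q X ≠ ⊥)
    (h2 : expect Q X ≠ ⊤) : Integrable X Q.1 := by
  have h3 := lintegral_neg_ne_top_of_expect_ne_bot h1
  refine integrable_of_lintegral (fun h4 => h2 ?_) h3
  rw [expect, h4, EReal.coe_ennreal_top, ← EReal.coe_ennreal_toReal h3]
  exact EReal.top_sub_coe _

theorem expect_eq_top {Q : ACProb P} {X : L0 P} (h1 : expect Q X ≠ ⊥)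
    (h2 : ¬ Integrable X Q.1) : expect Q X = ⊤ := by
  by_contra h
  exact h2 (integrable_of_expect h1 h)

theorem lintegral_ne_top_of_add {Q : ACProb P} {f g h : Ω → ℝ} (hf : Integrable f Q.1)
    (hg : ∫⁻ ω, ENNReal.ofReal (g ω) ∂Q.1 ≠ ⊤) (hh : ∀ᵐ ω ∂Q.1, h ω ≤ f ω + g ω) :
    ∫⁻ ω, ENNReal.ofReal (h ω) ∂Q.1 ≠ ⊤ := by
  refine ne_top_of_le_ne_top (ENNReal.add_ne_top.2 ⟨hf.lintegral_lt_top.ne, hg⟩)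
    ((lintegral_mono_ae (hh.mono fun ω h => (ENNReal.ofReal_le_ofReal h).trans
      ENNReal.ofReal_add_le)).trans (lintegral_add_left' hf.aemeasurable.ennreal_ofReal _).le)

/-- Adding an integrable variable does not change which of the positive and negative parts has
infinite integral, so the identity survives the convention ∞ - ∞ = -∞. -/
theorem expect_add {Q : ACProb P} {X Z : L0 P} (hZ : Integrable Z Q.1) :
    expect Q (Z + X) = (mean Q Z : ℝ) + expect Q X := by
  by_cases hX : Integrable X Q.1
  · rw [expect_of_integrable hX, expect_of_integrable (integrable_add hZ hX), mean_add hZ hX,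
      EReal.coe_add]
  have hadd := ae_of_ae Q (AEEqFun.coeFn_add Z X)
  have hZX : ¬ Integrable (Z + X : L0 P) Q.1 := fun h => hX <| by
    refine (h.sub hZ).congr (hadd.mono fun ω hω => ?_)
    simp [hω]
  by_cases hb : expect Q X = ⊥
  · rw [hb, EReal.add_bot]
    by_contra hb'
    have h3 := lintegral_neg_ne_top_of_expect_ne_bot hb'
    have h4 : ∫⁻ ω, ENNReal.ofReal (-X ω) ∂Q.1 ≠ ⊤ :=
      lintegral_ne_top_of_add hZ h3 (hadd.mono fun ω hω => by simp [hω])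
    by_cases h5 : ∫⁻ ω, ENNReal.ofReal (X ω) ∂Q.1 = ⊤
    · rw [expect, h5, EReal.coe_ennreal_top, ← EReal.coe_ennreal_toReal h4, EReal.top_sub_coe] at hb
      exact absurd hb (by simp)
    · exact hX (integrable_of_lintegral h5 h4)
  · rw [expect_eq_top hb hX, EReal.coe_add_top]
    refine expect_eq_top (fun hb' => ?_) hZX
    have h3 := lintegral_neg_ne_top_of_expect_ne_bot hb
    have h4 : ∫⁻ ω, ENNReal.ofReal (-(Z + X : L0 P) ω) ∂Q.1 ≠ ⊤ :=
      lintegral_ne_top_of_add hZ.neg h3 (hadd.mono fun ω hω => by rw [hω]; simp [add_comm])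
    by_cases h5 : ∫⁻ ω, ENNReal.ofReal ((Z + X : L0 P) ω) ∂Q.1 = ⊤
    · rw [expect, h5, EReal.coe_ennreal_top, ← EReal.coe_ennreal_toReal h4, EReal.top_sub_coe] at hb'
      exact absurd hb' (by simp)
    · exact hZX (integrable_of_lintegral h5 h4)

end CoherentEquilibrium

/-! ### Convex combinations of measures -/

namespace CoherentEquilibrium

variable {Ω : Type*} [MeasurableSpace Ω] {P : Measure Ω}

theorem expect_ne_bot {Q : ACProb P} {X : L0 P}
    (h : ∫⁻ ω, ENNReal.ofReal (-X ω) ∂Q.1 ≠ ⊤) : expect Q X ≠ ⊥ := by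
  rw [expect, ← EReal.coe_ennreal_toReal h, sub_eq_add_neg, Ne, EReal.add_eq_bot_iff, not_or,
    ← EReal.coe_neg]
  exact ⟨EReal.coe_ennreal_ne_bot _, EReal.coe_ne_bot _⟩

/-- The convex combination `a Q₁ + b Q₂`. -/
noncomputable def mix (Q₁ Q₂ : ACProb P) {a b : ℝ} (ha : 0 ≤ a) (hb : 0 ≤ b) (hab : a + b = 1) :
    ACProb P :=
  ⟨ENNReal.ofReal a • Q₁.1 + ENNReal.ofReal b • Q₂.1,
    ⟨by
      simp only [Measure.coe_add, Measure.coe_smul, Pi.add_apply, Pi.smul_apply, measure_univ,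
        smul_eq_mul, mul_one]
      rw [← ENNReal.ofReal_add ha hb, hab, ENNReal.ofReal_one]⟩,
    (Q₁.2.2.smul_left _).add_left (Q₂.2.2.smul_left _)⟩

section mix

variable {Q₁ Q₂ : ACProb P} {a b : ℝ} {ha : 0 ≤ a} {hb : 0 ≤ b} {hab : a + b = 1}

theorem mean_mix {X : L0 P} (h₁ : Integrable X Q₁.1) (h₂ : Integrable X Q₂.1) :
    mean (mix Q₁ Q₂ ha hb hab) X = a * mean Q₁ X + b * mean Q₂ X := by
  simp only [mean, mix]
  rw [integral_add_measure (h₁.smul_measure ENNReal.ofReal_ne_top)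
    (h₂.smul_measure ENNReal.ofReal_ne_top), integral_smul_measure, integral_smul_measure,
    ENNReal.toReal_ofReal ha, ENNReal.toReal_ofReal hb, smul_eq_mul, smul_eq_mul]

/-- Unless `u X = ⊥`, the negative part of X is integrable under both measures. Then either X is
integrable under the mixture and the two inequalities average, or its expectation there is `⊤`. Zero
weights are treated apart, since integrability under the mixture says nothing about a component of
weight zero. -/
theorem mix_mem_determiningSet {u : L0 P → EReal} (h₁ : Q₁ ∈ determiningSet u)
    (h₂ : Q₂ ∈ determiningSet u) : mix Q₁ Q₂ ha hb hab ∈ determiningSet u := by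
  intro X
  by_cases hbot : u X = ⊥
  · simp [hbot]
  rcases ha.eq_or_lt with rfl | ha'
  · have : mix Q₁ Q₂ ha hb hab = Q₂ := Subtype.ext (by simp [mix, show b = 1 by linarith])
    rw [this]; exact h₂ X
  rcases hb.eq_or_lt with rfl | hb'
  · have : mix Q₁ Q₂ ha hb hab = Q₁ := Subtype.ext (by simp [mix, show a = 1 by linarith])
    rw [this]; exact h₁ X
  have e₁ : expect Q₁ X ≠ ⊥ := fun h => hbot (le_bot_iff.1 (h ▸ h₁ X))
  have e₂ : expect Q₂ X ≠ ⊥ := fun h => hbot (le_bot_iff.1 (h ▸ h₂ X))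
  by_cases hi : Integrable X (mix Q₁ Q₂ ha hb hab).1
  · have i₁ : Integrable X Q₁.1 :=
      (integrable_smul_measure (by simpa using ha') ENNReal.ofReal_ne_top).1 hi.left_of_add_measure
    have i₂ : Integrable X Q₂.1 :=
      (integrable_smul_measure (by simpa using hb') ENNReal.ofReal_ne_top).1 hi.right_of_add_measure
    have h₁' := h₁ X
    have h₂' := h₂ X
    rw [expect_of_integrable i₁] at h₁'
    rw [expect_of_integrable i₂] at h₂'
    rw [expect_of_integrable hi, mean_mix i₁ i₂]
    have htop : u X ≠ ⊤ := fun h => by simp [h] at h₁'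
    lift u X to ℝ using ⟨htop, hbot⟩ with r
    rw [EReal.coe_le_coe_iff] at *
    have := mul_le_mul_of_nonneg_left h₁' ha
    have := mul_le_mul_of_nonneg_left h₂' hb
    have : r = a * r + b * r := by rw [← add_mul, hab, one_mul]
    linarith
  · rw [expect_eq_top (expect_ne_bot ?_) hi]
    · exact le_top
    · simp only [mix, lintegral_add_measure, lintegral_smul_measure, smul_eq_mul]
      exact ENNReal.add_ne_top.2
        ⟨ENNReal.mul_ne_top ENNReal.ofReal_ne_top (lintegral_neg_ne_top_of_expect_ne_bot e₁),
         ENNReal.mul_ne_top ENNReal.ofReal_ne_top (lintegral_neg_ne_top_of_expect_ne_bot e₂)⟩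

end mix

/-! ### Weak topology and the spaces `Ls1` -/

/-- The weak topology on measures, through their densities in `L¹(P)`. -/
noncomputable instance : TopologicalSpace (ACProb P) :=
  .induced (fun Q => toWeakSpace ℝ (Lp ℝ 1 P) (density Q)) inferInstance

theorem IsWeaklyCompact.isCompact {D : Set (ACProb P)} (h : IsWeaklyCompact D) : IsCompact D :=
  (Topology.IsInducing.isCompact_iff ⟨rfl⟩).2 h

/-- Integration against a bounded function, as a continuous functional on `L¹`. -/
theorem exists_continuousLinearMap_integral_mul {Z : Ω → ℝ} (hZ : Measurable Z) {C : ℝ}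
    (hC : ∀ ω, ‖Z ω‖ ≤ C) : ∃ φ : Lp ℝ 1 P →L[ℝ] ℝ, ∀ f, φ f = ∫ ω, Z ω * f ω ∂P := by
  have hint : ∀ f : Lp ℝ 1 P, Integrable (fun ω => Z ω * f ω) P := fun f =>
    (L1.integrable_coeFn f).bdd_mul hZ.aestronglyMeasurable (Eventually.of_forall hC)
  let φ : Lp ℝ 1 P →ₗ[ℝ] ℝ :=
    { toFun := fun f => ∫ ω, Z ω * f ω ∂P
      map_add' := fun f g => by
        rw [← integral_add (hint f) (hint g)]
        refine integral_congr_ae ((Lp.coeFn_add f g).mono fun ω h => ?_)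
        simp only [h, Pi.add_apply, mul_add]
      map_smul' := fun c f => by
        rw [RingHom.id_apply, smul_eq_mul, ← integral_const_mul]
        refine integral_congr_ae ((Lp.coeFn_smul c f).mono fun ω h => ?_)
        simp only [h, Pi.smul_apply, smul_eq_mul]
        ring }
  refine ⟨φ.mkContinuous C fun f => ?_, fun f => rfl⟩
  rw [L1.norm_eq_integral_norm, ← integral_const_mul]
  refine (norm_integral_le_integral_norm _).trans
    (integral_mono (hint f).norm ((L1.integrable_coeFn f).norm.const_mul C) fun ω => ?_)
  simp only [norm_mul]
  exact mul_le_mul_of_nonneg_right (hC ω) (norm_nonneg _)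

theorem continuous_integral_of_bounded [IsProbabilityMeasure P] {Z : Ω → ℝ} (hZ : Measurable Z)
    {C : ℝ} (hC : ∀ ω, ‖Z ω‖ ≤ C) : Continuous fun Q : ACProb P => ∫ ω, Z ω ∂Q.1 := by
  obtain ⟨φ, hφ⟩ := exists_continuousLinearMap_integral_mul (P := P) hZ hC
  have h : Continuous fun Q : ACProb P => φ (density Q) :=
    (WeakBilin.eval_continuous (topDualPairing ℝ (Lp ℝ 1 P)).flip φ).comp continuous_induced_dom
  refine h.congr fun Q => ?_
  rw [hφ, ← integral_toReal_rnDeriv_mul Q.2.2]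
  refine integral_congr_ae
    ((Measure.integrable_toReal_rnDeriv (μ := Q.1) (ν := P)).coeFn_toL1.mono fun ω h => ?_)
  simp only [density, h, mul_comm]

/-- The excess (|X| - C)⁺ replaces the tail |X| I(|X| > k): it is subadditive when the levels are
added, and it bounds the error of truncation at C. -/
theorem mem_Ls1_iff {D : Set (ACProb P)} {X : L0 P} :
    X ∈ Ls1 D ↔ ∀ ε : ENNReal, 0 < ε → ∃ C : ℝ, 0 ≤ C ∧
      ∀ Q ∈ D, ∫⁻ ω, ENNReal.ofReal (|X ω| - C) ∂Q.1 ≤ ε := by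
  have hm : ∀ k : ℝ, MeasurableSet {ω | k < |X ω|} := fun k =>
    measurableSet_lt measurable_const (measurable_coe X).abs
  rw [Ls1, Set.mem_ofPred_eq, ENNReal.tendsto_atTop_zero]
  constructor
  · intro h ε hε
    obtain ⟨n, hn⟩ := h ε hε
    refine ⟨n, by positivity, fun Q hQ => le_trans ?_ ((le_iSup₂ Q hQ).trans (hn n le_rfl))⟩
    rw [← lintegral_indicator (hm n)]
    refine lintegral_mono fun ω => ?_
    by_cases hω : (n : ℝ) < |X ω|
    · rw [Set.indicator_of_mem (show ω ∈ {ω | (n : ℝ) < |X ω|} from hω)]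
      exact ENNReal.ofReal_le_ofReal (by simp)
    · rw [ENNReal.ofReal_of_nonpos (by linarith)]
      exact zero_le
  · intro h ε hε
    obtain ⟨C, hC0, hC⟩ := h (ε / 2) (ENNReal.half_pos hε.ne')
    -- Where |X| > 2C one has |X| ≤ 2(|X| - C), hence the factor 2 and the ε / 2.
    refine ⟨⌈2 * C⌉₊, fun n hn => iSup₂_le fun Q hQ => ?_⟩
    have hn' : 2 * C ≤ n := Nat.ceil_le.1 hn
    calc ∫⁻ ω in {ω | (n : ℝ) < |X ω|}, ENNReal.ofReal |X ω| ∂Q.1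
        ≤ ∫⁻ ω in {ω | (n : ℝ) < |X ω|}, 2 * ENNReal.ofReal (|X ω| - C) ∂Q.1 := by
          refine setLIntegral_mono' (hm n) fun ω hω => ?_
          have hω' : (n : ℝ) < |X ω| := hω
          rw [← ENNReal.ofReal_ofNat, ← ENNReal.ofReal_mul (by norm_num)]
          exact ENNReal.ofReal_le_ofReal (by linarith)
      _ ≤ ∫⁻ ω, 2 * ENNReal.ofReal (|X ω| - C) ∂Q.1 := setLIntegral_le_lintegral _ _
      _ = 2 * ∫⁻ ω, ENNReal.ofReal (|X ω| - C) ∂Q.1 :=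
          lintegral_const_mul _ ((measurable_coe X).abs.sub_const C).ennreal_ofReal
      _ ≤ 2 * (ε / 2) := by gcongr; exact hC Q hQ
      _ = ε := ENNReal.mul_div_cancel (by norm_num) (by norm_num)

theorem Ls1_anti {D D' : Set (ACProb P)} (h : D ⊆ D') : Ls1 D' ⊆ Ls1 D := by
  intro X hX
  rw [mem_Ls1_iff] at *
  intro ε hε
  obtain ⟨C, h0, hC⟩ := hX ε hε
  exact ⟨C, h0, fun Q hQ => hC Q (h hQ)⟩

theorem integrable_of_mem_Ls1 {D : Set (ACProb P)} {X : L0 P} (hX : X ∈ Ls1 D) {Q : ACProb P}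
    (hQ : Q ∈ D) : Integrable X Q.1 := by
  obtain ⟨C, h0, hC⟩ := mem_Ls1_iff.1 hX 1 one_pos
  have hC' := ne_top_of_le_ne_top ENNReal.one_ne_top (hC Q hQ)
  exact integrable_of_lintegral
    (lintegral_ne_top_of_add (integrable_const C) hC'
      (Eventually.of_forall fun ω => by linarith [le_abs_self (X ω)]))
    (lintegral_ne_top_of_add (integrable_const C) hC'
      (Eventually.of_forall fun ω => by linarith [neg_le_abs (X ω)]))

theorem add_mem_Ls1 {D : Set (ACProb P)} {X Y : L0 P} (hX : X ∈ Ls1 D) (hY : Y ∈ Ls1 D) :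
    X + Y ∈ Ls1 D := by
  rw [mem_Ls1_iff] at *
  intro ε hε
  obtain ⟨B, hB0, hB⟩ := hX (ε / 2) (ENNReal.half_pos hε.ne')
  obtain ⟨C, hC0, hC⟩ := hY (ε / 2) (ENNReal.half_pos hε.ne')
  refine ⟨B + C, add_nonneg hB0 hC0, fun Q hQ => ?_⟩
  calc ∫⁻ ω, ENNReal.ofReal (|(X + Y : L0 P) ω| - (B + C)) ∂Q.1
      ≤ ∫⁻ ω, (ENNReal.ofReal (|X ω| - B) + ENNReal.ofReal (|Y ω| - C)) ∂Q.1 := by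
        refine lintegral_mono_ae ((ae_of_ae Q (AEEqFun.coeFn_add X Y)).mono fun ω h => ?_)
        rw [h, Pi.add_apply]
        exact (ENNReal.ofReal_le_ofReal (by linarith [abs_add_le (X ω) (Y ω)])).trans
          ENNReal.ofReal_add_le
    _ = _ := lintegral_add_left ((measurable_coe X).abs.sub_const B).ennreal_ofReal _
    _ ≤ ε / 2 + ε / 2 := add_le_add (hB Q hQ) (hC Q hQ)
    _ = ε := ENNReal.add_halves ε

theorem mem_Ls1_of_bounded {D : Set (ACProb P)} {X : L0 P} {C : ℝ} (h : ∀ᵐ ω ∂P, |X ω| ≤ C) :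
    X ∈ Ls1 D := by
  rw [mem_Ls1_iff]
  intro ε _
  refine ⟨max C 0, le_max_right _ _, fun Q _ => ?_⟩
  rw [lintegral_congr_ae (g := 0) ((ae_of_ae Q h).mono fun ω hω =>
    ENNReal.ofReal_of_nonpos (by linarith [le_max_left C 0]))]
  simp

theorem constant_mem_Ls1 (D : Set (ACProb P)) (c : ℝ) : (AEEqFun.const Ω c : L0 P) ∈ Ls1 D :=
  mem_Ls1_of_bounded (C := |c|) ((coeFn_constant c).mono fun ω h => by rw [h])

theorem zero_mem_Ls1 (D : Set (ACProb P)) : (0 : L0 P) ∈ Ls1 D := constant_mem_Ls1 D 0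

theorem smul_mem_Ls1 {D : Set (ACProb P)} {X : L0 P} (c : ℝ) (hX : X ∈ Ls1 D) :
    c • X ∈ Ls1 D := by
  rcases eq_or_ne c 0 with rfl | hc
  · rw [zero_smul]; exact zero_mem_Ls1 D
  rw [mem_Ls1_iff] at *
  intro ε hε
  have hc' : ENNReal.ofReal |c| ≠ 0 := by simpa using hc
  obtain ⟨C, h0, hC⟩ := hX (ε / ENNReal.ofReal |c|)
    (ENNReal.div_pos hε.ne' ENNReal.ofReal_ne_top)
  refine ⟨|c| * C, by positivity, fun Q hQ => ?_⟩
  calc ∫⁻ ω, ENNReal.ofReal (|(c • X : L0 P) ω| - |c| * C) ∂Q.1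
      = ∫⁻ ω, ENNReal.ofReal |c| * ENNReal.ofReal (|X ω| - C) ∂Q.1 := by
        refine lintegral_congr_ae ((ae_of_ae Q (AEEqFun.coeFn_smul c X)).mono fun ω h => ?_)
        simp only [h, Pi.smul_apply, smul_eq_mul, abs_mul]
        rw [← ENNReal.ofReal_mul (abs_nonneg c), mul_sub]
    _ = ENNReal.ofReal |c| * ∫⁻ ω, ENNReal.ofReal (|X ω| - C) ∂Q.1 :=
        lintegral_const_mul _ ((measurable_coe X).abs.sub_const C).ennreal_ofReal
    _ ≤ ENNReal.ofReal |c| * (ε / ENNReal.ofReal |c|) := by gcongr; exact hC Q hQ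
    _ = ε := ENNReal.mul_div_cancel hc' ENNReal.ofReal_ne_top

/-- Means of bounded variables are weakly continuous, and truncations of X approximate its mean
uniformly over D. -/
theorem continuousOn_mean [IsProbabilityMeasure P] {D : Set (ACProb P)} {X : L0 P}
    (hX : X ∈ Ls1 D) : ContinuousOn (fun Q => mean Q X) D := by
  refine continuousOn_of_uniform_approx_of_continuousOn fun s hs => ?_
  obtain ⟨ε, hε, hεs⟩ := Metric.mem_uniformity_dist.1 hs
  obtain ⟨C, hC0, hC⟩ := mem_Ls1_iff.1 hX (ENNReal.ofReal (ε / 2)) (by simpa using hε)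
  set Z : Ω → ℝ := fun ω => max (-C) (min (X ω) C) with hZ
  have hZm : Measurable Z := measurable_const.max ((measurable_coe X).min measurable_const)
  have hZb : ∀ ω, ‖Z ω‖ ≤ C := fun ω =>
    abs_le.2 ⟨le_max_left _ _, max_le (by linarith) (min_le_right _ _)⟩
  refine ⟨_, (continuous_integral_of_bounded hZm hZb).continuousOn, fun Q hQ => hεs ?_⟩
  have hXi := integrable_of_mem_Ls1 hX hQ
  have hZi : Integrable Z Q.1 :=
    (integrable_const C).mono' hZm.aestronglyMeasurable (Eventually.of_forall hZb)
  rw [Real.dist_eq, mean, ← integral_sub hXi hZi, ← Real.norm_eq_abs]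
  refine lt_of_le_of_lt (norm_integral_le_lintegral_norm _) ?_
  refine lt_of_le_of_lt (ENNReal.toReal_mono ENNReal.ofReal_ne_top (le_trans (lintegral_mono
    fun ω => ENNReal.ofReal_le_ofReal_iff'.2 ?_) (hC Q hQ))) ?_
  -- The truncation error is either at most |X| - C or zero.
  · rw [Real.norm_eq_abs, hZ]
    simp only
    by_contra! h
    obtain ⟨h1, h2⟩ := h
    rcases le_total (X ω) C with h3 | h3
    · rw [min_eq_left h3] at h1 h2
      rcases le_total (-C) (X ω) with h4 | h4
      · rw [max_eq_right h4] at h2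
        simp at h2
      · rw [max_eq_left h4, abs_of_nonpos (by linarith), abs_of_nonpos (by linarith)] at h1
        linarith
    · rw [min_eq_right h3, max_eq_right (by linarith), abs_of_nonneg (by linarith),
        abs_of_nonneg (by linarith)] at h1
      linarith
  · rw [ENNReal.toReal_ofReal (by linarith)]
    linarith

end CoherentEquilibrium

/-! ### Finite sums in `EReal` -/

theorem EReal.coe_sum_real {ι : Type*} (s : Finset ι) (f : ι → ℝ) :
    ((∑ i ∈ s, f i : ℝ) : EReal) = ∑ i ∈ s, (f i : EReal) := by
  classical
  induction s using Finset.induction_on with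
  | empty => simp
  | insert a s ha ih => rw [Finset.sum_insert ha, Finset.sum_insert ha, EReal.coe_add, ih]

theorem EReal.ne_bot_of_sum_ne_bot {ι : Type*} {s : Finset ι} {f : ι → EReal}
    (h : ∑ i ∈ s, f i ≠ ⊥) {i : ι} (hi : i ∈ s) : f i ≠ ⊥ := by
  classical
  intro hf
  rw [← Finset.add_sum_erase s f hi, hf, EReal.bot_add] at h
  exact h rfl

/-! ### Separation of measures and coherent utilities -/

namespace CoherentEquilibrium

variable {Ω : Type*} [MeasurableSpace Ω] {P : Measure Ω}

theorem constant_eq_smul (c : ℝ) : (AEEqFun.const Ω c : L0 P) = c • AEEqFun.const Ω (1 : ℝ) := by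
  refine AEEqFun.ext ?_
  filter_upwards [coeFn_constant (P := P) c, coeFn_constant (P := P) 1,
    AEEqFun.coeFn_smul c (AEEqFun.const Ω (1 : ℝ) : L0 P)] with ω h1 h2 h3
  rw [h1, h3, Pi.smul_apply, h2, smul_eq_mul, mul_one]

theorem sum_constant {ι : Type*} (s : Finset ι) (a : ι → ℝ) :
    ∑ i ∈ s, (AEEqFun.const Ω (a i) : L0 P) = AEEqFun.const Ω (∑ i ∈ s, a i) := by
  rw [constant_eq_smul, Finset.sum_smul]
  exact Finset.sum_congr rfl fun i _ => constant_eq_smul (a i)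

theorem constant_add_constant_neg (c : ℝ) :
    (AEEqFun.const Ω c : L0 P) + AEEqFun.const Ω (-c) = 0 := by
  rw [constant_eq_smul c, constant_eq_smul (-c), neg_smul, add_neg_cancel]

theorem exists_mean_eq_measureReal {B : Set Ω} (hB : MeasurableSet B) :
    ∃ Z : L0 P, Z ∈ Ls1 (Set.univ : Set (ACProb P)) ∧ ∀ Q : ACProb P, mean Q Z = Q.1.real B := by
  have hm : AEStronglyMeasurable (B.indicator fun _ => (1 : ℝ)) P :=
    (measurable_const.indicator hB).aestronglyMeasurable
  have hc := AEEqFun.coeFn_mk _ hm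
  refine ⟨AEEqFun.mk _ hm, mem_Ls1_of_bounded (C := 1) (hc.mono fun ω h => ?_), fun Q => ?_⟩
  · rw [h]
    by_cases hω : ω ∈ B <;> simp [hω]
  · rw [mean, integral_congr_ae (ae_of_ae Q hc), integral_indicator_const _ hB, smul_eq_mul, mul_one]

theorem integrable_of_mem_Ls1_univ {Z : L0 P} (hZ : Z ∈ Ls1 (Set.univ : Set (ACProb P)))
    (Q : ACProb P) : Integrable Z Q.1 :=
  integrable_of_mem_Ls1 hZ (Set.mem_univ Q)

theorem exists_separating {Q Q' : ACProb P} (h : Q ≠ Q') :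
    ∃ Z : L0 P, Z ∈ Ls1 (Set.univ : Set (ACProb P)) ∧ mean Q Z = 0 ∧ 0 < mean Q' Z := by
  obtain ⟨B, hB, hne⟩ : ∃ B, MeasurableSet B ∧ Q.1.real B ≠ Q'.1.real B := by
    by_contra! hall
    refine h (Subtype.ext (Measure.ext fun B hB => ?_))
    exact (measureReal_eq_measureReal_iff (measure_ne_top _ _) (measure_ne_top _ _)).1 (hall B hB)
  obtain ⟨Z, hZ, hmean⟩ := exists_mean_eq_measureReal (P := P) hB
  -- Scaling the centered indicator by the signed gap `d` gives mean d² under `Q'`, whatever the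
  -- sign of `d`.
  set d := mean Q' Z - mean Q Z with hd
  have hd0 : d ≠ 0 := by rw [hd, hmean, hmean]; exact sub_ne_zero.2 hne.symm
  have hc := constant_mem_Ls1 (P := P) Set.univ (-mean Q Z)
  have hm : ∀ R : ACProb P, mean R (d • (Z + AEEqFun.const Ω (-mean Q Z))) =
      d * (mean R Z - mean Q Z) := fun R => by
    rw [mean_smul, mean_add (integrable_of_mem_Ls1_univ hZ R) (integrable_of_mem_Ls1_univ hc R),
      mean_constant]
    ring
  refine ⟨d • (Z + AEEqFun.const Ω (-mean Q Z)), smul_mem_Ls1 d (add_mem_Ls1 hZ hc), ?_, ?_⟩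
  · rw [hm, sub_self, mul_zero]
  · rw [hm]
    exact mul_self_pos.2 hd0

section Utility

variable {u : L0 P → EReal}

theorem IsCoherentUtility.eq_iInf (hu : IsCoherentUtility u) (X : L0 P) :
    u X = ⨅ Q ∈ determiningSet u, expect Q X := by
  obtain ⟨D, -, h⟩ := hu
  refine le_antisymm (le_iInf₂ fun Q hQ => hQ X) ?_
  rw [h X]
  refine le_iInf₂ fun Q hQ => iInf₂_le Q fun Z => ?_
  rw [h Z]
  exact iInf₂_le Q hQ

theorem IsCoherentUtility.determiningSet_nonempty (hu : IsCoherentUtility u) :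
    (determiningSet u).Nonempty := by
  obtain ⟨D, ⟨Q, hQ⟩, h⟩ := hu
  refine ⟨Q, fun X => ?_⟩
  rw [h X]
  exact iInf₂_le Q hQ

theorem expect_add_constant (Q : ACProb P) (X : L0 P) (c : ℝ) :
    expect Q (X + AEEqFun.const Ω c) = expect Q X + c := by
  rw [add_comm, expect_add (integrable_constant Q c), mean_constant, add_comm]

theorem IsCoherentUtility.add_constant_le (hu : IsCoherentUtility u) (X : L0 P) (c : ℝ) :
    u X + c ≤ u (X + AEEqFun.const Ω c) := by
  rw [hu.eq_iInf (X + _)]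
  refine le_iInf₂ fun Q hQ => ?_
  rw [expect_add_constant]
  exact add_le_add_left (hQ X) _

theorem IsCoherentUtility.add_constant (hu : IsCoherentUtility u) (X : L0 P) (c : ℝ) :
    u (X + AEEqFun.const Ω c) = u X + c := by
  refine le_antisymm ?_ (hu.add_constant_le X c)
  -- The reverse inequality is the one already shown, applied to the shift by `-c`.
  have h := add_le_add_left (hu.add_constant_le (X + AEEqFun.const Ω c) (-c)) (c : EReal)
  rw [add_assoc, add_assoc, constant_add_constant_neg, add_zero, ← EReal.coe_add, neg_add_cancel,
    EReal.coe_zero, add_zero] at h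
  exact h

theorem mem_Ls1_of_univ {D : Set (ACProb P)} {Z : L0 P}
    (hZ : Z ∈ Ls1 (Set.univ : Set (ACProb P))) : Z ∈ Ls1 D :=
  Ls1_anti (Set.subset_univ D) hZ

theorem compactSpace_determiningSet (hD : IsWeaklyCompact (determiningSet u)) :
    CompactSpace (determiningSet u) :=
  isCompact_iff_compactSpace.1 hD.isCompact

variable [IsProbabilityMeasure P]

/-- A continuous function attains its minimum on a nonempty compact set. -/
theorem IsCoherentUtility.exists_eq_mean (hu : IsCoherentUtility u)
    (hD : IsWeaklyCompact (determiningSet u)) {Z : L0 P} (hZ : Z ∈ Ls1 (determiningSet u)) :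
    ∃ Q ∈ determiningSet u, u Z = (mean Q Z : ℝ) := by
  obtain ⟨Q, hQ, hmin⟩ := hD.isCompact.exists_isMinOn hu.determiningSet_nonempty
    (continuousOn_mean hZ)
  refine ⟨Q, hQ, le_antisymm ?_ ?_⟩
  · rw [← expect_of_integrable (integrable_of_mem_Ls1 hZ hQ)]
    exact hQ Z
  · rw [hu.eq_iInf]
    refine le_iInf₂ fun Q' hQ' => ?_
    rw [expect_of_integrable (integrable_of_mem_Ls1 hZ hQ'), EReal.coe_le_coe_iff]
    exact hmin hQ'

theorem continuous_mean_restrict {D : Set (ACProb P)} {Z : L0 P} (hZ : Z ∈ Ls1 D) :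
    Continuous fun k : D => mean k.1 Z :=
  continuousOn_iff_continuous_domRestrict.1 (continuousOn_mean hZ)

/-- A measure under which centered bounded perturbations of `W` have bounded utility belongs to the
determining set. -/
theorem mem_determiningSet_of_forall_le (hu : IsCoherentUtility u)
    (hD : IsWeaklyCompact (determiningSet u)) {W : L0 P} (hW : W ∈ Ls1 (determiningSet u))
    {Q : ACProb P} {v : ℝ}
    (h : ∀ Z ∈ Ls1 (Set.univ : Set (ACProb P)), mean Q Z = 0 → u (W + Z) ≤ v) :
    Q ∈ determiningSet u := by
  by_contra hQ
  have := compactSpace_determiningSet hD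
  have hWi : ∀ k : determiningSet u, Integrable W k.1.1 := fun k => integrable_of_mem_Ls1 hW k.2
  -- If `Q` were outside, each `k` in the determining set could be separated from it by a variable
  -- centered under `Q`, and a large multiple makes the function positive at `k`. The minimax
  -- theorem then yields a single `Z` with `u (W + Z) > v`.
  let F : Set (determiningSet u → ℝ) :=
    {f | ∃ Z ∈ Ls1 (Set.univ : Set (ACProb P)), mean Q Z = 0 ∧
      f = fun k => mean k.1 W + mean k.1 Z - v}
  suffices hpos : ∃ f ∈ F, ∀ k, 0 < f k by
    obtain ⟨f, ⟨Z, hZ, hZ0, rfl⟩, hf⟩ := hpos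
    have hWZ := add_mem_Ls1 hW (mem_Ls1_of_univ (D := determiningSet u) hZ)
    obtain ⟨Q', hQ', h'⟩ := hu.exists_eq_mean hD hWZ
    have := h Z hZ hZ0
    rw [h', EReal.coe_le_coe_iff, mean_add (hWi ⟨Q', hQ'⟩) (integrable_of_mem_Ls1_univ hZ Q')] at this
    linarith [hf ⟨Q', hQ'⟩]
  refine exists_forall_pos_of_forall_exists_pos ?_ ?_ ?_ ?_ ?_
  · rintro _ ⟨Z₁, hZ₁, h₁, rfl⟩ _ ⟨Z₂, hZ₂, h₂, rfl⟩ a b ha hb hab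
    have hm : ∀ R : ACProb P, mean R (a • Z₁ + b • Z₂) = a * mean R Z₁ + b * mean R Z₂ := fun R => by
      rw [mean_add (integrable_smul a (integrable_of_mem_Ls1_univ hZ₁ R))
        (integrable_smul b (integrable_of_mem_Ls1_univ hZ₂ R)), mean_smul, mean_smul]
    refine ⟨a • Z₁ + b • Z₂, add_mem_Ls1 (smul_mem_Ls1 a hZ₁) (smul_mem_Ls1 b hZ₂), ?_, ?_⟩
    · rw [hm, h₁, h₂]; ring
    · funext k
      simp only [Pi.add_apply, Pi.smul_apply, smul_eq_mul, hm]
      linear_combination (mean k.1 W - v) * hab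
  · refine ⟨_, 0, zero_mem_Ls1 _, ?_, rfl⟩
    have := mean_smul Q 0 0
    rwa [zero_smul, zero_mul] at this
  · rintro _ ⟨Z, hZ, -, rfl⟩
    exact ((continuous_mean_restrict hW).add
      (continuous_mean_restrict (mem_Ls1_of_univ hZ))).sub continuous_const
  · intro k₁ k₂ a b ha hb hab
    refine ⟨⟨mix k₁.1 k₂.1 ha hb hab, mix_mem_determiningSet k₁.2 k₂.2⟩, ?_⟩
    rintro _ ⟨Z, hZ, -, rfl⟩
    simp only
    rw [mean_mix (hWi k₁) (hWi k₂),
      mean_mix (integrable_of_mem_Ls1_univ hZ _) (integrable_of_mem_Ls1_univ hZ _)]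
    linear_combination (v) * hab
  · intro k
    obtain ⟨Z, hZ, hZ0, hpos⟩ := exists_separating (Q := Q) (Q' := k.1)
      fun h => hQ (h ▸ k.2)
    obtain ⟨n, hn⟩ := Archimedean.arch (1 + |v - mean k.1 W|) hpos
    refine ⟨_, ⟨(n : ℝ) • Z, smul_mem_Ls1 _ hZ, ?_, rfl⟩, ?_⟩
    · rw [mean_smul, hZ0, mul_zero]
    · simp only [mean_smul]
      rw [nsmul_eq_mul] at hn
      linarith [le_abs_self (v - mean k.1 W)]

end Utility

end CoherentEquilibrium

/-! ### Test directions and the duality for the overall utility -/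

namespace CoherentEquilibrium

variable {Ω : Type*} [MeasurableSpace Ω] {P : Measure Ω} {N : ℕ} {u : Fin N → L0 P → EReal}
  {A : Fin N → PointedCone ℝ (L0 P)} {W X Y : Fin N → L0 P} {Q : ACProb P}

theorem mean_zero (Q : ACProb P) : mean Q 0 = 0 := by
  have := mean_smul Q 0 0
  rwa [zero_smul, zero_mul] at this

theorem sum_mean_single {ι : Type*} [Fintype ι] [DecidableEq ι] (k : ι → ACProb P) (i : ι)
    (Z : L0 P) : ∑ n, mean (k n) (Pi.single (M := fun _ => L0 P) i Z n) = mean (k i) Z := by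
  rw [Finset.sum_eq_single i]
  · rw [Pi.single_eq_same]
  · intro j _ hj
    rw [Pi.single_eq_of_ne hj, mean_zero]
  · simp

theorem mem_commonSet (hQ : Q ∈ ⋂ n, determiningSet (u n) ∩ riskNeutral (A n)) :
    Q ∈ commonSet u :=
  Set.mem_iInter.2 fun n => (Set.mem_iInter.1 hQ n).1

theorem sum_single {ι E : Type*} [Fintype ι] [DecidableEq ι] [AddCommMonoid E] (i : ι) (Z : E) :
    ∑ n, Pi.single (M := fun _ => E) i Z n = Z := by
  rw [Finset.sum_eq_single i]
  · rw [Pi.single_eq_same]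
  · intro j _ hj
    rw [Pi.single_eq_of_ne hj]
  · simp

theorem single_mem_Ls1 {ι : Type*} [DecidableEq ι] {D : ι → Set (ACProb P)} {i : ι} {Z : L0 P}
    (hZ : Z ∈ Ls1 (D i)) (n : ι) : Pi.single (M := fun _ => L0 P) i Z n ∈ Ls1 (D n) := by
  rcases eq_or_ne n i with rfl | hn
  · rwa [Pi.single_eq_same]
  · rw [Pi.single_eq_of_ne hn]; exact zero_mem_Ls1 _

/-- Bounded transfers and integrable elements of the cones. -/
structure IsTestDirection (u : Fin N → L0 P → EReal) (A : Fin N → PointedCone ℝ (L0 P))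
    (X Y : Fin N → L0 P) : Prop where
  mem_cone : ∀ n, X n ∈ A n
  mem_Ls1 : ∀ n, X n ∈ Ls1 (determiningSet (u n))
  transfer_mem_Ls1 : ∀ n, Y n ∈ Ls1 (Set.univ : Set (ACProb P))
  transfer_sum : ∑ n, Y n = 0

namespace IsTestDirection

theorem zero : IsTestDirection u A 0 0 :=
  ⟨fun n => (A n).zero_mem, fun _ => zero_mem_Ls1 _, fun _ => zero_mem_Ls1 _, by simp⟩

theorem smul (h : IsTestDirection u A X Y) {c : ℝ} (hc : 0 ≤ c) :
    IsTestDirection u A (c • X) (c • Y) :=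
  ⟨fun n => (A n).smul_mem hc (h.mem_cone n), fun n => smul_mem_Ls1 c (h.mem_Ls1 n),
    fun n => smul_mem_Ls1 c (h.transfer_mem_Ls1 n), by
      simp only [Pi.smul_apply]
      rw [← Finset.smul_sum, h.transfer_sum, smul_zero]⟩

theorem add (h : IsTestDirection u A X Y) {X' Y' : Fin N → L0 P} (h' : IsTestDirection u A X' Y') :
    IsTestDirection u A (X + X') (Y + Y') :=
  ⟨fun n => (A n).add_mem (h.mem_cone n) (h'.mem_cone n),
    fun n => add_mem_Ls1 (h.mem_Ls1 n) (h'.mem_Ls1 n),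
    fun n => add_mem_Ls1 (h.transfer_mem_Ls1 n) (h'.transfer_mem_Ls1 n), by
      simp only [Pi.add_apply]
      rw [Finset.sum_add_distrib, h.transfer_sum, h'.transfer_sum, add_zero]⟩

theorem add_mem_Ls1 (h : IsTestDirection u A X Y) (n : Fin N) :
    X n + Y n ∈ Ls1 (determiningSet (u n)) :=
  CoherentEquilibrium.add_mem_Ls1 (h.mem_Ls1 n) (mem_Ls1_of_univ (h.transfer_mem_Ls1 n))

theorem integrable (h : IsTestDirection u A X Y) {n : Fin N} (hQ : Q ∈ determiningSet (u n)) :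
    Integrable (X n + Y n : L0 P) Q.1 :=
  integrable_of_mem_Ls1 (h.add_mem_Ls1 n) hQ

theorem isFeasible (h : IsTestDirection u A X Y) : IsFeasible u A X Y :=
  ⟨h.mem_cone, fun n => mem_Ls1_of_univ (h.transfer_mem_Ls1 n), h.transfer_sum⟩

theorem mean_smul_add (X Y : Fin N → L0 P) (c : ℝ) (n : Fin N) (Q : ACProb P) :
    mean Q ((c • X) n + (c • Y) n) = c * mean Q (X n + Y n) := by
  rw [← mean_smul, smul_add]; rfl

/-- If two agents use different measures, a bounded transfer between them gains. If all use one
measure Q, then Q fails risk neutrality for some cone, and consistency makes the failure visible on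
an element integrable enough to serve as a test. -/
theorem exists_gain (hA : ∀ n, IsConsistent (determiningSet (u n)) (A n)) {k : Fin N → ACProb P}
    (hk : ∀ n, k n ∈ determiningSet (u n))
    (hno : ¬ ∃ Q ∈ ⋂ n, determiningSet (u n) ∩ riskNeutral (A n), ∀ n, k n = Q)
    [IsProbabilityMeasure P] :
    ∃ X Y, IsTestDirection u A X Y ∧ 0 < ∑ n, mean (k n) (X n + Y n) := by
  classical
  by_cases hall : ∃ Q, ∀ n, k n = Q
  · obtain ⟨Q, hQ⟩ := hall
    have hQC : Q ∉ ⋂ n, determiningSet (u n) ∩ riskNeutral (A n) := fun h => hno ⟨Q, h, hQ⟩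
    rw [Set.mem_iInter] at hQC
    push Not at hQC
    obtain ⟨n, hn⟩ := hQC
    obtain ⟨A', hA', heq⟩ := hA n
    rw [heq] at hn
    have hQn : Q ∈ determiningSet (u n) := hQ n ▸ hk n
    obtain ⟨ξ, hξ, hpos⟩ : ∃ ξ ∈ A', 0 < expect Q ξ := by
      by_contra! h
      exact hn ⟨hQn, h⟩
    obtain ⟨hξA, hξL⟩ := hA' hξ
    rw [expect_of_integrable (integrable_of_mem_Ls1 hξL hQn)] at hpos
    refine ⟨Pi.single n ξ, 0, ⟨fun m => ?_, single_mem_Ls1 (D := fun n => determiningSet (u n)) hξL,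
      fun _ => zero_mem_Ls1 _, by simp⟩, ?_⟩
    · rcases eq_or_ne m n with rfl | hm
      · simpa using hξA
      · rw [Pi.single_eq_of_ne hm]; exact (A m).zero_mem
    · simp only [Pi.zero_apply, add_zero]
      rw [sum_mean_single k n ξ, hQ n]
      exact_mod_cast hpos
  · obtain ⟨i, j, hij⟩ : ∃ i j, k j ≠ k i := by
      by_contra! h
      rcases isEmpty_or_nonempty (Fin N) with _ | ⟨⟨i⟩⟩
      -- With no agents, any measure is vacuously common to all.
      · exact hall ⟨⟨P, inferInstance, Measure.AbsolutelyContinuous.rfl⟩, fun n => isEmptyElim n⟩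
      · exact hall ⟨k i, fun n => h i n⟩
    obtain ⟨Z, hZ, h0, hpos⟩ := exists_separating hij
    have hZ' := smul_mem_Ls1 (-1) hZ
    have h₁ := single_mem_Ls1 (D := fun _ : Fin N => Set.univ) (i := i) hZ
    have h₂ := single_mem_Ls1 (D := fun _ : Fin N => Set.univ) (i := j) hZ'
    have s₁ := sum_single i Z
    have s₂ := sum_single j ((-1 : ℝ) • Z)
    have m₁ := sum_mean_single k i Z
    have m₂ := sum_mean_single k j ((-1 : ℝ) • Z)
    generalize (Pi.single i Z : Fin N → L0 P) = Y₁ at h₁ s₁ m₁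
    generalize (Pi.single j ((-1 : ℝ) • Z) : Fin N → L0 P) = Y₂ at h₂ s₂ m₂
    refine ⟨0, Y₁ + Y₂, ⟨fun n => (A n).zero_mem, fun _ => zero_mem_Ls1 _,
      fun n => CoherentEquilibrium.add_mem_Ls1 (h₁ n) (h₂ n), ?_⟩, ?_⟩
    · simp only [Pi.add_apply]
      rw [Finset.sum_add_distrib, s₁, s₂, neg_smul, one_smul, add_neg_cancel]
    · have : ∀ n, mean (k n) ((0 : Fin N → L0 P) n + (Y₁ + Y₂) n) =
          mean (k n) (Y₁ n) + mean (k n) (Y₂ n) := fun n => by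
        rw [Pi.zero_apply, zero_add, Pi.add_apply,
          mean_add (integrable_of_mem_Ls1_univ (h₁ n) _) (integrable_of_mem_Ls1_univ (h₂ n) _)]
      rw [Finset.sum_congr rfl fun n _ => this n, Finset.sum_add_distrib, m₁, m₂, mean_smul, h0]
      linarith

end IsTestDirection

variable [IsProbabilityMeasure P]

/-- The strong half of the duality: the minimax theorem is applied to the total mean minus `r`, as a
function of a tuple with one measure per agent. A pair positive at every tuple is positive at the
tuple of minimizing measures, where the means are the utilities. -/
theorem exists_isFeasible_lt (hu : ∀ n, IsCoherentUtility (u n))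
    (hD : ∀ n, IsWeaklyCompact (determiningSet (u n)))
    (hA : ∀ n, IsConsistent (determiningSet (u n)) (A n))
    (hW : ∀ n, W n ∈ Ls1 (determiningSet (u n))) {r : ℝ}
    (hr : ∀ Q ∈ ⋂ n, determiningSet (u n) ∩ riskNeutral (A n), r < ∑ n, mean Q (W n)) :
    ∃ X Y, IsFeasible u A X Y ∧ (r : EReal) < ∑ n, u n (W n + X n + Y n) := by
  have := fun n => compactSpace_determiningSet (hD n)
  have hWi : ∀ (k : ∀ n, determiningSet (u n)) n, Integrable (W n) (k n).1.1 := fun k n =>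
    integrable_of_mem_Ls1 (hW n) (k n).2
  let F : Set ((∀ n, determiningSet (u n)) → ℝ) :=
    {f | ∃ X Y, IsTestDirection u A X Y ∧
      f = fun k => ∑ n, (mean (k n).1 (W n) + mean (k n).1 (X n + Y n)) - r}
  suffices hpos : ∃ f ∈ F, ∀ k, 0 < f k by
    obtain ⟨f, ⟨X, Y, hXY, rfl⟩, hf⟩ := hpos
    refine ⟨X, Y, hXY.isFeasible, ?_⟩
    have hmem : ∀ n, W n + X n + Y n ∈ Ls1 (determiningSet (u n)) := fun n => by
      rw [add_assoc]
      exact add_mem_Ls1 (hW n) (hXY.add_mem_Ls1 n)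
    choose q hq hqu using fun n => (hu n).exists_eq_mean (hD n) (hmem n)
    rw [Finset.sum_congr rfl fun n _ => hqu n, ← EReal.coe_sum_real, EReal.coe_lt_coe_iff]
    have := hf fun n => ⟨q n, hq n⟩
    refine (sub_pos.1 this).trans_eq (Finset.sum_congr rfl fun n _ => ?_)
    rw [add_assoc, mean_add (integrable_of_mem_Ls1 (hW n) (hq n)) (hXY.integrable (hq n))]
  refine exists_forall_pos_of_forall_exists_pos ?_ ⟨_, 0, 0, .zero, rfl⟩ ?_ ?_ ?_
  · rintro _ ⟨X, Y, h, rfl⟩ _ ⟨X', Y', h', rfl⟩ a b ha hb hab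
    refine ⟨_, _, (h.smul ha).add (h'.smul hb), ?_⟩
    funext k
    have : ∀ n, mean (k n).1 ((a • X + b • X') n + (a • Y + b • Y') n) =
        a * mean (k n).1 (X n + Y n) + b * mean (k n).1 (X' n + Y' n) := fun n => by
      rw [← IsTestDirection.mean_smul_add, ← IsTestDirection.mean_smul_add,
        ← mean_add ((h.smul ha).integrable (k n).2) ((h'.smul hb).integrable (k n).2),
        Pi.add_apply, Pi.add_apply, add_add_add_comm]
    simp only [this]
    simp only [Pi.add_apply, Pi.smul_apply, smul_eq_mul, Finset.sum_add_distrib,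
      ← Finset.mul_sum]
    linear_combination (∑ n, mean (k n).1 (W n) - r) * hab
  · rintro _ ⟨X, Y, h, rfl⟩
    refine (continuous_finsetSum _ fun n _ => ?_).sub continuous_const
    exact ((continuous_mean_restrict (hW n)).add
      (continuous_mean_restrict (h.add_mem_Ls1 n))).comp (continuous_apply n)
  · intro k₁ k₂ a b ha hb hab
    refine ⟨fun n => ⟨mix (k₁ n).1 (k₂ n).1 ha hb hab,
      mix_mem_determiningSet (k₁ n).2 (k₂ n).2⟩, ?_⟩
    rintro _ ⟨X, Y, h, rfl⟩
    simp only
    rw [Finset.sum_congr rfl fun n _ => by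
      rw [mean_mix (hWi k₁ n) (hWi k₂ n), mean_mix (h.integrable (k₁ n).2) (h.integrable (k₂ n).2)]]
    simp only [Finset.sum_add_distrib, ← Finset.mul_sum]
    linear_combination r * hab
  · intro k
    by_cases hex : ∃ Q ∈ ⋂ n, determiningSet (u n) ∩ riskNeutral (A n), ∀ n, (k n).1 = Q
    · obtain ⟨Q, hQ, hk⟩ := hex
      refine ⟨_, ⟨0, 0, .zero, rfl⟩, ?_⟩
      simpa [mean_zero, hk] using hr Q hQ
    · obtain ⟨X, Y, hXY, hpos⟩ := IsTestDirection.exists_gain hA (fun n => (k n).2) hex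
      obtain ⟨m, hm⟩ := Archimedean.arch (1 + |r - ∑ n, mean (k n).1 (W n)|) hpos
      refine ⟨_, ⟨_, _, hXY.smul (Nat.cast_nonneg m), rfl⟩, ?_⟩
      simp only [IsTestDirection.mean_smul_add, Finset.sum_add_distrib, ← Finset.mul_sum]
      rw [nsmul_eq_mul] at hm
      linarith [le_abs_self (r - ∑ n, mean (k n).1 (W n))]

end CoherentEquilibrium

/-! ### Supporting measures and equilibria -/

namespace CoherentEquilibrium

variable {Ω : Type*} [MeasurableSpace Ω] {P : Measure Ω} {N : ℕ} {u : Fin N → L0 P → EReal}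
  {A : Fin N → PointedCone ℝ (L0 P)} {W X Y : Fin N → L0 P} {Q : ACProb P}

/-- Weak duality for one agent. Only W + Y is split off, so X need not be integrable. -/
theorem le_expect_of_riskNeutral {u : L0 P → EReal} {A : PointedCone ℝ (L0 P)} {W X Y : L0 P}
    (hQ : Q ∈ determiningSet u ∩ riskNeutral A) (hW : Integrable W Q.1) (hX : X ∈ A)
    (hY : Integrable Y Q.1) : u (W + X + Y) ≤ ((mean Q W + mean Q Y : ℝ) : EReal) := by
  refine (hQ.1 _).trans ?_
  rw [add_right_comm, expect_add (integrable_add hW hY), mean_add hW hY]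
  exact (add_le_add_right (hQ.2 X hX) _).trans (add_zero _).le

theorem IsFeasible.integrable (h : IsFeasible u A X Y) (hQ : Q ∈ commonSet u) (n : Fin N) :
    Integrable (Y n) Q.1 :=
  integrable_of_mem_Ls1 (h.2.1 n) hQ

theorem IsFeasible.sum_mean (h : IsFeasible u A X Y) (hQ : Q ∈ commonSet u) :
    ∑ n, mean Q (Y n) = 0 := by
  rw [← (integrable_sum Finset.univ fun n _ => h.integrable hQ n).2, h.2.2, mean_zero]

theorem isFeasible_zero : IsFeasible u A 0 0 := IsTestDirection.zero.isFeasible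

theorem IsFeasible.add_constant (h : IsFeasible u A X Y) {a : Fin N → ℝ} (ha : ∑ n, a n = 0) :
    IsFeasible u A X fun n => Y n + AEEqFun.const Ω (a n) := by
  refine ⟨h.1, fun n => add_mem_Ls1 (h.2.1 n) (constant_mem_Ls1 _ _), ?_⟩
  rw [Finset.sum_add_distrib, h.2.2, zero_add, sum_constant, ha]
  rfl

theorem TransferEquiv.symm {Y' : Fin N → L0 P} (h : TransferEquiv Y' Y) : TransferEquiv Y Y' := by
  obtain ⟨a, ha, h⟩ := h
  refine ⟨fun n => -a n, by rw [Finset.sum_neg_distrib, ha, neg_zero], fun n => ?_⟩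
  rw [h n, add_assoc, constant_add_constant_neg, add_zero]

/-- `Q` is a risk-neutral common measure whose value of the aggregate endowment is the overall
utility of `(X, Y)`. -/
def IsSupporting (u : Fin N → L0 P → EReal) (A : Fin N → PointedCone ℝ (L0 P))
    (W X Y : Fin N → L0 P) (Q : ACProb P) : Prop :=
  Q ∈ (⋂ n, determiningSet (u n) ∩ riskNeutral (A n)) ∧
    ∃ v : Fin N → ℝ, (∀ n, u n (W n + X n + Y n) = v n) ∧ ∑ n, mean Q (W n) = ∑ n, v n

variable (hW : ∀ n, W n ∈ Ls1 (determiningSet (u n)))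
include hW

theorem integrable_endowment (hQ : Q ∈ commonSet u) (n : Fin N) : Integrable (W n) Q.1 :=
  integrable_of_mem_Ls1 (hW n) (Set.mem_iInter.1 hQ n)

theorem expect_sum_endowment (hQ : Q ∈ commonSet u) :
    expect Q (∑ n, W n) = ((∑ n, mean Q (W n) : ℝ) : EReal) := by
  obtain ⟨h1, h2⟩ := integrable_sum Finset.univ fun n _ => integrable_endowment hW hQ n
  rw [expect_of_integrable h1, h2]

theorem IsFeasible.le_mean (h : IsFeasible u A X Y)
    (hQ : Q ∈ ⋂ n, determiningSet (u n) ∩ riskNeutral (A n)) (n : Fin N) :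
    u n (W n + X n + Y n) ≤ ((mean Q (W n) + mean Q (Y n) : ℝ) : EReal) :=
  le_expect_of_riskNeutral (Set.mem_iInter.1 hQ n) (integrable_endowment hW (mem_commonSet hQ) n)
    (h.1 n) (h.integrable (mem_commonSet hQ) n)

theorem IsFeasible.ne_top (h : IsFeasible u A X Y)
    (hQ : Q ∈ ⋂ n, determiningSet (u n) ∩ riskNeutral (A n)) (n : Fin N) :
    u n (W n + X n + Y n) ≠ ⊤ :=
  ne_top_of_le_ne_top (EReal.coe_ne_top _) (h.le_mean hW hQ n)

theorem IsFeasible.sum_le_mean (h : IsFeasible u A X Y)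
    (hQ : Q ∈ ⋂ n, determiningSet (u n) ∩ riskNeutral (A n)) :
    ∑ n, u n (W n + X n + Y n) ≤ ((∑ n, mean Q (W n) : ℝ) : EReal) := by
  refine (Finset.sum_le_sum fun n _ => h.le_mean hW hQ n).trans ?_
  rw [← EReal.coe_sum_real, Finset.sum_add_distrib, h.sum_mean (mem_commonSet hQ), add_zero]

theorem IsFeasible.sum_le_mean_of_eq (h : IsFeasible u A X Y)
    (hQ : Q ∈ ⋂ n, determiningSet (u n) ∩ riskNeutral (A n)) {v : Fin N → ℝ}
    (hv : ∀ n, u n (W n + X n + Y n) = v n) : ∑ n, v n ≤ ∑ n, mean Q (W n) := by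
  have := h.sum_le_mean hW hQ
  rwa [Finset.sum_congr rfl fun n _ => hv n, ← EReal.coe_sum_real, EReal.coe_le_coe_iff] at this

theorem IsSupporting.isParetoEquilibrium (h : IsSupporting u A W X Y Q)
    (hXY : IsFeasible u A X Y) : IsParetoEquilibrium u A W X Y := by
  obtain ⟨hQ, v, hv, hsum⟩ := h
  refine ⟨hXY, ?_⟩
  rintro ⟨X', Y', h', hle, m, hlt⟩
  have hbot : ∀ n, u n (W n + X' n + Y' n) ≠ ⊥ := fun n hb => by
    have := hle n
    rw [hb, hv n, le_bot_iff] at this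
    exact EReal.coe_ne_bot _ this
  obtain ⟨w, hw⟩ : ∃ w : Fin N → ℝ, ∀ n, u n (W n + X' n + Y' n) = w n :=
    ⟨_, fun n => (EReal.coe_toReal (h'.ne_top hW hQ n) (hbot n)).symm⟩
  have hle' : ∀ n, v n ≤ w n := fun n => by
    have := hle n
    rwa [hv n, hw n, EReal.coe_le_coe_iff] at this
  have hlt' : v m < w m := by rwa [hv m, hw m, EReal.coe_lt_coe_iff] at hlt
  have h1 := h'.sum_le_mean_of_eq hW hQ hw
  have h2 := Finset.sum_lt_sum (fun n (_ : n ∈ Finset.univ) => hle' n) ⟨m, Finset.mem_univ m, hlt'⟩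
  linarith

/-- Termwise inequalities with equal finite sums are termwise equalities. -/
theorem IsSupporting.mean_eq (h : IsSupporting u A W X Y Q) (hXY : IsFeasible u A X Y) (n : Fin N) :
    u n (W n + X n + Y n) = ((mean Q (W n) + mean Q (Y n) : ℝ) : EReal) := by
  obtain ⟨hQ, v, hv, hsum⟩ := h
  have hle : ∀ n, v n ≤ mean Q (W n) + mean Q (Y n) := fun n => by
    have := hXY.le_mean hW hQ n
    rwa [hv n, EReal.coe_le_coe_iff] at this
  have heq : ∑ n, v n = ∑ n, (mean Q (W n) + mean Q (Y n)) := by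
    rw [Finset.sum_add_distrib, hXY.sum_mean (mem_commonSet hQ), add_zero, hsum]
  rw [hv n, (Finset.sum_eq_sum_iff_of_le fun n _ => hle n).1 heq n (Finset.mem_univ n)]

theorem IsSupporting.expect_eq (h : IsSupporting u A W X Y Q) (hXY : IsFeasible u A X Y)
    (n : Fin N) : expect Q (W n + X n + Y n) = u n (W n + X n + Y n) := by
  have hQ := Set.mem_iInter.1 h.1 n
  refine le_antisymm ?_ (hQ.1 _)
  have hWi := integrable_endowment hW (mem_commonSet h.1) n
  have hYi := hXY.integrable (mem_commonSet h.1) n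
  rw [h.mean_eq hW hXY n, add_right_comm, expect_add (integrable_add hWi hYi), mean_add hWi hYi]
  exact (add_le_add_right (hQ.2 _ (hXY.1 n)) _).trans (add_zero _).le

theorem IsSupporting.mem_extremeMeasures (hu : ∀ n, IsCoherentUtility (u n))
    (h : IsSupporting u A W X Y Q) (hXY : IsFeasible u A X Y) :
    Q ∈ ⋂ n, extremeMeasures (determiningSet (u n)) (W n + X n + Y n) ∩ riskNeutral (A n) := by
  refine Set.mem_iInter.2 fun n => ?_
  have hQ := Set.mem_iInter.1 h.1 n
  have he := h.expect_eq hW hXY n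
  refine ⟨⟨hQ.1, by rw [he, (hu n).eq_iInf], ?_, ?_⟩, hQ.2⟩
  · rw [he, h.mean_eq hW hXY n]; exact EReal.coe_ne_bot _
  · rw [he, h.mean_eq hW hXY n]; exact EReal.coe_ne_top _

/-- Finiteness of the expectation makes `X n` integrable under `Q`, and risk neutrality for both `X
n` and its negative gives it mean zero; this is where linearity enters. -/
theorem isSupporting_of_mem_extremeMeasures (hu : ∀ n, IsCoherentUtility (u n))
    (hA : ∀ n, ∃ V : Submodule ℝ (L0 P), (A n : Set (L0 P)) = V) (hXY : IsFeasible u A X Y)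
    (hQ : Q ∈ ⋂ n, extremeMeasures (determiningSet (u n)) (W n + X n + Y n) ∩ riskNeutral (A n)) :
    IsSupporting u A W X Y Q := by
  rw [Set.mem_iInter] at hQ
  have hQC : Q ∈ ⋂ n, determiningSet (u n) ∩ riskNeutral (A n) :=
    Set.mem_iInter.2 fun n => ⟨(hQ n).1.1, (hQ n).2⟩
  have hmem := mem_commonSet hQC
  refine ⟨hQC, fun n => mean Q (W n) + mean Q (Y n), fun n => ?_, ?_⟩
  · obtain ⟨⟨-, heq, hbot, htop⟩, hR⟩ := hQ n
    rw [(hu n).eq_iInf, ← heq]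
    have hWY := integrable_add (integrable_endowment hW hmem n) (hXY.integrable hmem n)
    rw [add_right_comm, expect_add hWY] at hbot htop ⊢
    have hXi : Integrable (X n) Q.1 := by
      refine integrable_of_expect (fun h => hbot ?_) (fun h => htop ?_)
      · rw [h, EReal.add_bot]
      · rw [h, EReal.coe_add_top]
    have hneg : (-1 : ℝ) • X n ∈ A n := by
      obtain ⟨V, hV⟩ := hA n
      have hX : X n ∈ (A n : Set (L0 P)) := hXY.1 n
      change (-1 : ℝ) • X n ∈ (A n : Set (L0 P))
      rw [hV] at hX ⊢
      exact V.smul_mem _ hX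
    have h1 := hR _ (hXY.1 n)
    have h2 := hR _ hneg
    rw [expect_of_integrable hXi, ← EReal.coe_zero, EReal.coe_le_coe_iff] at h1
    rw [expect_of_integrable (integrable_smul _ hXi), mean_smul, ← EReal.coe_zero,
      EReal.coe_le_coe_iff] at h2
    have h0 : mean Q (X n) = 0 := by linarith
    rw [expect_of_integrable hXi, h0, EReal.coe_zero, add_zero,
      mean_add (integrable_endowment hW hmem n) (hXY.integrable hmem n)]
  · rw [Finset.sum_add_distrib, hXY.sum_mean hmem, add_zero]

theorem IsSupporting.mem_equilibriumMeasures (hu : ∀ n, IsCoherentUtility (u n))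
    (h : IsSupporting u A W X Y Q) (hXY : IsFeasible u A X Y) :
    Q ∈ equilibriumMeasures u A W X Y := by
  have hmem := mem_commonSet h.1
  -- The cash transfers -E_Q Yₙ center every Yₙ and balance out.
  have hsum : ∑ n, -mean Q (Y n) = 0 := by
    rw [Finset.sum_neg_distrib, hXY.sum_mean hmem, neg_zero]
  have hfeas := hXY.add_constant hsum
  refine ⟨_, ⟨_, hsum, fun n => rfl⟩, hfeas, fun n => ?_, fun n => ⟨?_, ?_⟩⟩
  · rw [expect_add_constant, expect_of_integrable (hXY.integrable hmem n), ← EReal.coe_add,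
      add_neg_cancel, EReal.coe_zero]
  · refine ⟨X n, hXY.1 n, _, hfeas.integrable hmem n, ?_, rfl⟩
    rw [expect_add_constant, expect_of_integrable (hXY.integrable hmem n), ← EReal.coe_add,
      add_neg_cancel, EReal.coe_zero]
  · rintro _ ⟨ξ, hξ, η, hη, hη0, rfl⟩
    rw [expect_of_integrable hη, ← EReal.coe_zero, EReal.coe_eq_coe_iff] at hη0
    refine (le_expect_of_riskNeutral (Set.mem_iInter.1 h.1 n) (integrable_endowment hW hmem n) hξ
      hη).trans (le_of_eq ?_)
    rw [← add_assoc, (hu n).add_constant, h.mean_eq hW hXY n, ← EReal.coe_add, hη0]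
    congr 1
    ring

variable [IsProbabilityMeasure P] (hu : ∀ n, IsCoherentUtility (u n))
  (hD : ∀ n, IsWeaklyCompact (determiningSet (u n)))
  (hA : ∀ n, IsConsistent (determiningSet (u n)) (A n))
include hu hD hA

theorem IsArrowDebreuEquilibrium.isSupporting
    (hC : (⋂ n, determiningSet (u n) ∩ riskNeutral (A n)).Nonempty)
    (h : IsArrowDebreuEquilibrium u A W X Y Q) : IsSupporting u A W X Y Q := by
  obtain ⟨Q₀, hQ₀⟩ := hC
  obtain ⟨hXY, -, hmax⟩ := h
  have hle : ∀ n, ∀ ξ ∈ A n, ∀ η : L0 P, Integrable η Q.1 → mean Q η = 0 →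
      u n (W n + ξ + η) ≤ u n (W n + X n + Y n) := fun n ξ hξ η hη h0 =>
    (hmax n).2 ⟨ξ, hξ, η, hη, by rw [expect_of_integrable hη, h0, EReal.coe_zero], rfl⟩
  choose q hq hqW using fun n => (hu n).exists_eq_mean (hD n) (hW n)
  have hbot : ∀ n, u n (W n + X n + Y n) ≠ ⊥ := fun n hb => by
    have := hle n 0 (A n).zero_mem 0 (integrable_of_mem_Ls1 (zero_mem_Ls1 Set.univ) trivial)
      (mean_zero Q)
    rw [add_zero, add_zero, hb, hqW n, le_bot_iff] at this
    exact EReal.coe_ne_bot _ this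
  -- `Q₀` serves only to exclude the value `⊤`.
  obtain ⟨v, hv⟩ : ∃ v : Fin N → ℝ, ∀ n, u n (W n + X n + Y n) = v n :=
    ⟨_, fun n => (EReal.coe_toReal (hXY.ne_top hW hQ₀ n) (hbot n)).symm⟩
  simp only [hv] at hle
  have hQD : ∀ n, Q ∈ determiningSet (u n) := fun n =>
    mem_determiningSet_of_forall_le (hu n) (hD n) (hW n) (v := v n) fun Z hZ h0 => by
      have := hle n 0 (A n).zero_mem Z (integrable_of_mem_Ls1_univ hZ Q) h0
      rwa [add_zero] at this
  -- An agent can exchange any `Q`-integrable position for its mean under `Q`.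
  have hcenter : ∀ {Z : L0 P}, Integrable Z Q.1 →
      ∃ η : L0 P, Integrable η Q.1 ∧ mean Q η = 0 ∧ Z + η = AEEqFun.const Ω (mean Q Z) := by
    intro Z hZ
    have hneg := integrable_smul (-1) hZ
    refine ⟨(-1 : ℝ) • Z + AEEqFun.const Ω (mean Q Z),
      integrable_add hneg (integrable_constant Q _), ?_, ?_⟩
    · rw [mean_add hneg (integrable_constant Q _), mean_smul, mean_constant]
      ring
    · rw [neg_smul, one_smul, add_neg_cancel_left]
  have hQC : Q ∈ ⋂ n, determiningSet (u n) ∩ riskNeutral (A n) := by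
    refine Set.mem_iInter.2 fun n => ?_
    obtain ⟨A', hA', heq⟩ := hA n
    rw [heq]
    refine ⟨hQD n, fun ξ hξ => ?_⟩
    obtain ⟨hξA, hξL⟩ := hA' hξ
    have hξi := integrable_of_mem_Ls1 hξL (hQD n)
    rw [expect_of_integrable hξi, ← EReal.coe_zero, EReal.coe_le_coe_iff]
    by_contra! hpos
    -- Trading `m` copies of ξ for their mean would lift the utility of `W n` beyond the maximum `v
    -- n`.
    obtain ⟨m, hm⟩ := Archimedean.arch (1 + |v n - mean (q n) (W n)|) hpos
    rw [nsmul_eq_mul] at hm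
    obtain ⟨η, hη, h0, hη'⟩ := hcenter (integrable_smul (m : ℝ) hξi)
    have := hle n _ ((A n).smul_mem (Nat.cast_nonneg m) hξA) η hη h0
    rw [add_assoc, hη', mean_smul, (hu n).add_constant, hqW n, ← EReal.coe_add,
      EReal.coe_le_coe_iff] at this
    linarith [le_abs_self (v n - mean (q n) (W n))]
  refine ⟨hQC, v, hv, le_antisymm (Finset.sum_le_sum fun n _ => ?_)
    (hXY.sum_le_mean_of_eq hW hQC hv)⟩
  -- Exchanging the endowment itself for cash shows `v n ≥ mean Q (W n)`, given that the utility of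
  -- zero is zero.
  obtain ⟨η, hη, h0, hη'⟩ := hcenter (integrable_endowment hW (mem_commonSet hQC) n)
  have := hle n 0 (A n).zero_mem η hη h0
  rw [add_zero, hη', ← zero_add (AEEqFun.const Ω _ : L0 P), (hu n).add_constant] at this
  obtain ⟨q', -, h'⟩ := (hu n).exists_eq_mean (hD n) (zero_mem_Ls1 _)
  rwa [h', mean_zero, ← EReal.coe_add, zero_add, EReal.coe_le_coe_iff] at this

/-- Balanced cash transfers leave the sum of utilities unchanged, so supporting measures are the
same for equivalent Y. -/
theorem mem_equilibriumMeasures_iff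
    (hC : (⋂ n, determiningSet (u n) ∩ riskNeutral (A n)).Nonempty) (hXY : IsFeasible u A X Y) :
    Q ∈ equilibriumMeasures u A W X Y ↔ IsSupporting u A W X Y Q := by
  refine ⟨?_, fun h => h.mem_equilibriumMeasures hW hu hXY⟩
  rintro ⟨Y', hYY', hAD⟩
  obtain ⟨hQ, v, hv, hsum⟩ := hAD.isSupporting hW hu hD hA hC
  obtain ⟨a, ha, hY⟩ := hYY'.symm
  refine ⟨hQ, fun n => v n + a n, fun n => ?_, ?_⟩
  · rw [hY n, ← add_assoc, (hu n).add_constant, hv n, EReal.coe_add]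
  · rw [Finset.sum_add_distrib, ha, add_zero, hsum]

theorem IsParetoEquilibrium.exists_isSupporting
    (hC : (⋂ n, determiningSet (u n) ∩ riskNeutral (A n)).Nonempty)
    (h : IsParetoEquilibrium u A W X Y) : ∃ Q, IsSupporting u A W X Y Q := by
  classical
  obtain ⟨Q₀, hQ₀⟩ := hC
  obtain ⟨hXY, hopt⟩ := h
  have htop := hXY.ne_top hW hQ₀
  have hbot : ∀ n, u n (W n + X n + Y n) ≠ ⊥ := by
    intro m hm
    choose q hq hqW using fun n => (hu n).exists_eq_mean (hD n) (hW n)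
    -- If agent `m` has utility `⊥`, drop all trades and use cash: the others are paid up to at
    -- least their former utility, and `m` bears the total cost, ending with a finite value. For
    -- another agent at `⊥`, `toReal` gives 0, which is still an improvement.
    set b : Fin N → ℝ := fun n => (u n (W n + X n + Y n)).toReal - mean (q n) (W n) with hb
    have hsum : ∑ n, (b n - if n = m then ∑ i, b i else 0) = 0 := by
      simp [Finset.sum_sub_distrib]
    have hval : ∀ n c, u n (W n + (0 : Fin N → L0 P) n + ((0 : Fin N → L0 P) n +
        AEEqFun.const Ω c)) = ((mean (q n) (W n) + c : ℝ) : EReal) := fun n c => by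
      rw [Pi.zero_apply, add_zero, zero_add, (hu n).add_constant, hqW n, EReal.coe_add]
    refine hopt ⟨0, _, isFeasible_zero.add_constant hsum, fun n => ?_, m, ?_⟩
    · rw [hval]
      rcases eq_or_ne n m with rfl | hn
      · rw [hm]; exact bot_le
      · rw [if_neg hn, sub_zero, hb, add_sub_cancel]
        exact EReal.le_coe_toReal (htop n)
    · rw [hval, hm]
      exact EReal.bot_lt_coe _
  obtain ⟨v, hv⟩ : ∃ v : Fin N → ℝ, ∀ n, u n (W n + X n + Y n) = v n :=
    ⟨_, fun n => (EReal.coe_toReal (htop n) (hbot n)).symm⟩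
  by_contra! hno
  obtain ⟨X', Y', h', hlt⟩ := exists_isFeasible_lt (r := ∑ n, v n) hu hD hA hW fun Q hQ =>
    lt_of_le_of_ne (hXY.sum_le_mean_of_eq hW hQ hv) fun heq => hno Q ⟨hQ, v, hv, heq.symm⟩
  obtain ⟨w, hw⟩ : ∃ w : Fin N → ℝ, ∀ n, u n (W n + X' n + Y' n) = w n :=
    ⟨_, fun n => (EReal.coe_toReal (h'.ne_top hW hQ₀ n)
      (EReal.ne_bot_of_sum_ne_bot hlt.ne_bot (Finset.mem_univ n))).symm⟩
  rw [Finset.sum_congr rfl fun n _ => hw n, ← EReal.coe_sum_real, EReal.coe_lt_coe_iff] at hlt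
  have hN : 0 < N := by
    rcases Nat.eq_zero_or_pos N with rfl | hN
    · simp at hlt
    · exact hN
  have hN' : (0 : ℝ) < N := by exact_mod_cast hN
  -- Splitting the surplus equally makes every agent strictly better off by δ.
  set δ : ℝ := (∑ n, w n - ∑ n, v n) / N with hδ
  have hδ0 : 0 < δ := div_pos (sub_pos.2 hlt) hN'
  have hsum : ∑ n, (v n - w n + δ) = 0 := by
    rw [Finset.sum_add_distrib, Finset.sum_sub_distrib, Finset.sum_const, Finset.card_univ,
      Fintype.card_fin, nsmul_eq_mul, hδ, mul_div_cancel₀ _ hN'.ne']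
    ring
  have hgain : ∀ n, u n (W n + X n + Y n) <
      u n (W n + X' n + (Y' n + AEEqFun.const Ω (v n - w n + δ))) := fun n => by
    rw [← add_assoc, (hu n).add_constant, hv n, hw n, ← EReal.coe_add, EReal.coe_lt_coe_iff]
    linarith
  exact hopt ⟨X', _, h'.add_constant hsum, fun n => (hgain n).le, ⟨0, hN⟩, hgain _⟩

/-- One supporting measure exists, so the minimum of E_Q W over the risk-neutral common measures
equals the overall utility; supporting means attaining it. -/
theorem IsParetoEquilibrium.isSupporting_iff
    (hC : (⋂ n, determiningSet (u n) ∩ riskNeutral (A n)).Nonempty)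
    (h : IsParetoEquilibrium u A W X Y) :
    IsSupporting u A W X Y Q ↔
      Q ∈ extremeMeasures (⋂ n, determiningSet (u n) ∩ riskNeutral (A n)) (∑ n, W n) := by
  constructor
  · rintro ⟨hQ, v, hv, hsum⟩
    have he := expect_sum_endowment hW (mem_commonSet hQ)
    refine ⟨hQ, le_antisymm (le_iInf₂ fun Q' hQ' => ?_) (iInf₂_le Q hQ), ?_, ?_⟩
    · rw [he, expect_sum_endowment hW (mem_commonSet hQ'), EReal.coe_le_coe_iff, hsum]
      exact h.1.sum_le_mean_of_eq hW hQ' hv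
    · rw [he]; exact EReal.coe_ne_bot _
    · rw [he]; exact EReal.coe_ne_top _
  · rintro ⟨hQ, hinf, -, -⟩
    obtain ⟨Q₀, hQ₀, v, hv, hsum⟩ := h.exists_isSupporting hW hu hD hA hC
    refine ⟨hQ, v, hv, le_antisymm ?_ (h.1.sum_le_mean_of_eq hW hQ hv)⟩
    rw [← hsum, ← EReal.coe_le_coe_iff, ← expect_sum_endowment hW (mem_commonSet hQ),
      ← expect_sum_endowment hW (mem_commonSet hQ₀), hinf]
    exact iInf₂_le Q₀ hQ₀

theorem maxOverallUtility_lt_top_iff :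
    maxOverallUtility u A W < ⊤ ↔ (⋂ n, determiningSet (u n) ∩ riskNeutral (A n)).Nonempty := by
  constructor
  · intro h
    by_contra hC
    rw [Set.not_nonempty_iff_eq_empty] at hC
    refine h.ne ((EReal.eq_top_iff_forall_lt _).2 fun r => ?_)
    -- Over an empty set of measures the hypothesis on `r` is vacuous.
    obtain ⟨X, Y, hXY, hlt⟩ := exists_isFeasible_lt (r := r) hu hD hA hW (by simp [hC])
    exact hlt.trans_le (le_sSup ⟨X, Y, hXY, rfl⟩)
  · rintro ⟨Q, hQ⟩
    refine lt_of_le_of_lt (sSup_le ?_) (EReal.coe_lt_top (∑ n, mean Q (W n)))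
    rintro _ ⟨X, Y, hXY, rfl⟩
    exact hXY.sum_le_mean hW hQ

end CoherentEquilibrium

theorem mainTheorem1 {Ω : Type*} [MeasurableSpace Ω] (P : Measure Ω) [IsProbabilityMeasure P]
    {N : ℕ} (u : Fin N → L0 P → EReal)
    (hu : ∀ n, IsCoherentUtility (u n))
    (hD : ∀ n, IsWeaklyCompact (determiningSet (u n)))
    (A : Fin N → PointedCone ℝ (L0 P))
    (hA : ∀ n, IsConsistent (determiningSet (u n)) (A n))
    (W : Fin N → L0 P) (hW : ∀ n, W n ∈ Ls1 (determiningSet (u n))) :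
    (maxOverallUtility u A W < ⊤ ↔
      (⋂ n, determiningSet (u n) ∩ riskNeutral (A n)).Nonempty) ∧
    (maxOverallUtility u A W < ⊤ →
      ∀ X Y : Fin N → L0 P, IsFeasible u A X Y →
        (IsParetoEquilibrium u A W X Y ↔
          ∃ (Q : ACProb P) (Y' : Fin N → L0 P),
            TransferEquiv Y' Y ∧ IsArrowDebreuEquilibrium u A W X Y' Q) ∧
        (IsParetoEquilibrium u A W X Y →
          equilibriumMeasures u A W X Y =
            extremeMeasures (⋂ n, determiningSet (u n) ∩ riskNeutral (A n)) (∑ n, W n)) ∧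
        ((∀ n, ∃ V : Submodule ℝ (L0 P), (A n : Set (L0 P)) = V) →
          (IsParetoEquilibrium u A W X Y ↔
            (⋂ n, extremeMeasures (determiningSet (u n)) (W n + X n + Y n) ∩
              riskNeutral (A n)).Nonempty) ∧
          equilibriumMeasures u A W X Y =
            ⋂ n, extremeMeasures (determiningSet (u n)) (W n + X n + Y n) ∩
              riskNeutral (A n))) := by
  have hM := maxOverallUtility_lt_top_iff hW hu hD hA
  refine ⟨hM, fun hlt X Y hXY => ?_⟩
  have hC := hM.1 hlt
  have hE := fun Q => mem_equilibriumMeasures_iff (Q := Q) hW hu hD hA hC hXY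
  have hPareto : IsParetoEquilibrium u A W X Y ↔ ∃ Q, IsSupporting u A W X Y Q :=
    ⟨fun h => h.exists_isSupporting hW hu hD hA hC, fun ⟨_, h⟩ => h.isParetoEquilibrium hW hXY⟩
  refine ⟨hPareto.trans (exists_congr fun Q => (hE Q).symm),
    fun h => Set.ext fun Q => (hE Q).trans (h.isSupporting_iff hW hu hD hA hC), fun hlin => ?_⟩
  have hX : ∀ Q, IsSupporting u A W X Y Q ↔
      Q ∈ ⋂ n, extremeMeasures (determiningSet (u n)) (W n + X n + Y n) ∩ riskNeutral (A n) :=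
    fun Q => ⟨fun h => h.mem_extremeMeasures hW hu hXY,
      isSupporting_of_mem_extremeMeasures hW hu hlin hXY⟩
  exact ⟨hPareto.trans (exists_congr hX), Set.ext fun Q => (hE Q).trans (hX Q)⟩
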